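/- Let $\mathbb F$ be a field. A p-family over a commutative ring $R$ is a sequence $(f)=(f_n)_{n\in\mathbb N}$ of multivariate polynomials over $R$ whose numbers of variables and degrees are polynomially bounded in $n$. VP is the set of p-families over a field that are computed by algebraic circuits (with additions and multiplications of fan-in two, whose leaves are variables and field constants) with polynomially bounded number of nodes; VBP and VF are defined in the same way with skew circuits (each multiplication gate has a leaf among its inputs) and with formulas (circuits that are rooted trees), respectively. Let $\mathrm{HC}_n=\sum_\pi\prod_{i=1}^n x_{i,\pi(i)}$, where $\pi$ ranges over the cyclic permutations of $n$ symbols. Reductions. Write $f\le g$ if $f$ arises from $g$ by substituting variables and constants for the variables, and let $L^g(f)$ be the least number of nodes of a circuit with addition gates, multiplication gates and $g$-oracle gates that computes $f$. For p-families over a field $\mathbb F$, - $(f)\le_{\mathsf p}(g)$ (p-projection) if there is a polynomially bounded $t:\mathbb N\to\mathbb N$ with $f_n\le g_{t(n)}$ for all $n$; - $(f)\le_{\mathsf c}(g)$ (c-reduction) if there is a polynomially bounded $t$ such that $L^{g_{t(n)}}(f_n)$ is polynomially bounded; - $(f)\trianglelefteq_{\mathsf p}(g)$ (border p-projection) if there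 is a polynomially bounded $t$ such that for every $n$ there is a polynomial $h$ over $\mathbb F[\varepsilon]$ with $f_n+\varepsilon h\le g_{t(n)}$ over $\mathbb F(\varepsilon)$; - $(f)\trianglelefteq_{\mathsf c}(g)$ (border c-reduction) if there is a polynomially bounded $t$ such that the minimum over all polynomials $h$ over $\mathbb F[\varepsilon]$ of $L^{g_{t(n)}}(f_n+\varepsilon h)$, computed over $\mathbb F(\varepsilon)$, is polynomially bounded in $n$. VNP is the set of p-families $(f)$ with $(f)\le_{\mathsf p}(\mathrm{HC})$. For each of these four reductions $\le$, let $\mathrm{VNPC}(\le)$ be the set of $(f)\in\mathrm{VNP}$ with $(\mathrm{HC})\le(f)$, and for $\mathrm{C}\in\{\mathrm{VF},\mathrm{VBP},\mathrm{VP}\}$ let $\mathrm{CC}(\le)$ be the set of $(f)\in\mathrm C$ such that $(g)\le(f)$ for all $(g)\in\mathrm C$. All these classes are defined over every field. Density. For a class $A$ (defined over every field), the border closure $\overline A$ over $\mathbb F$ is the set of p-families $(f)$ over $\mathbb F$ for which there is a p-family $(g)$ over $\mathbb F[\varepsilon]$ such that $(f)+\varepsilon(g)$ lies in the class $A$ over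 the field $\mathbb F(\varepsilon)$. A class $A$ is a dense subset of a class $B$ over $\mathbb F$ if $A\subseteq B\subseteq\overline A$ over $\mathbb F$. Theorem. Over every field $\mathbb F$ the following hold. 1. For each $\le$ among $\le_{\mathsf p},\le_{\mathsf c},\trianglelefteq_{\mathsf p},\trianglelefteq_{\mathsf c}$: $\mathrm{VNPC}(\le)$ is a dense subset of $\mathrm{VNP}$, $\mathrm{VFC}(\le)$ is a dense subset of $\mathrm{VF}$, $\mathrm{VBPC}(\le)$ is a dense subset of $\mathrm{VBP}$, and $\mathrm{VPC}(\le)$ is a dense subset of $\mathrm{VP}$. 2. $\mathrm{VNP}\setminus\mathrm{VNPC}(\le_{\mathsf p})$ is a dense subset of $\mathrm{VNP}$, $\mathrm{VF}\setminus\mathrm{VFC}(\le_{\mathsf p})$ is a dense subset of $\mathrm{VF}$, $\mathrm{VBP}\setminus\mathrm{VBPC}(\le_{\mathsf p})$ is a dense subset of $\mathrm{VBP}$, and $\mathrm{VP}\setminus\mathrm{VPC}(\le_{\mathsf p})$ is a dense subset of $\mathrm{VP}$. -/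

import Mathlib

open MvPolynomial

universe u

namespace AlgComplexity

/-- A sequence of natural numbers is polynomially bounded. -/
def PolyBounded (t : ℕ → ℕ) : Prop :=
  ∃ p : Polynomial ℕ, ∀ n, t n ≤ p.eval n

/-- A sequence of multivariate polynomials over `R`, in variables taken from a countable supply. -/
abbrev Family (R : Type u) [CommRing R] : Type u := ℕ → MvPolynomial ℕ R

/-- A p-family: the number of occurring variables and the degree are polynomially bounded. -/
def IsPFamily {R : Type u} [CommRing R] (f : Family R) : Prop :=
  PolyBounded (fun n => (f n).vars.card) ∧ PolyBounded (fun n => (f n).totalDegree)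

/-! ### Circuits -/

/-- The label of a node of a circuit with node set `V` that may use, besides additions and
multiplications of fan-in two, oracle gates for the polynomials in `S`. The inputs of an oracle
gate for `g` are indexed by the variables of `g`. -/
inductive Gate {K : Type u} [Field K] (S : Set (MvPolynomial ℕ K)) (V : Type) : Type u
  | var (i : ℕ) : Gate S V
  | const (c : K) : Gate S V
  | add (a b : V) : Gate S V
  | mul (a b : V) : Gate S V
  | oracle (g : MvPolynomial ℕ K) (hg : g ∈ S) (args : g.vars → V) : Gate S V

namespace Gate

variable {K : Type u} [Field K] {S : Set (MvPolynomial ℕ K)} {V : Type}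

/-- The node `v` is a direct input of the gate. -/
def HasInput (v : V) : Gate S V → Prop
  | var _ => False
  | const _ => False
  | add a b => v = a ∨ v = b
  | mul a b => v = a ∨ v = b
  | oracle _ _ args => ∃ i, v = args i

/-- The gate is a leaf, that is, it is labelled with a variable or a constant. -/
def IsLeaf : Gate S V → Prop
  | var _ => True
  | const _ => True
  | _ => False

/-- The polynomial computed at a gate, given the polynomials `val` computed at all nodes. -/
noncomputable def value (val : V → MvPolynomial ℕ K) : Gate S V → MvPolynomial ℕ K
  | var i => X i
  | const c => C c
  | add a b => val a + val b
  | mul a b => val a * val b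
  | oracle g _ args => aeval (fun i : ℕ => if h : i ∈ g.vars then val (args ⟨i, h⟩) else 0) g

end Gate

/-- An algebraic circuit over `K` with oracle gates for the polynomials in `S`: a finite directed
acyclic graph with labelled nodes and a distinguished output node. -/
structure Circuit {K : Type u} [Field K] (S : Set (MvPolynomial ℕ K)) where
  Node : Type
  fintypeNode : Fintype Node
  gate : Node → Gate S Node
  acyclic : WellFounded (fun a b : Node => (gate b).HasInput a)
  root : Node

namespace Circuit

variable {K : Type u} [Field K] {S : Set (MvPolynomial ℕ K)}

/-- The size of a circuit is its number of nodes. -/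
def size (c : Circuit S) : ℕ := @Fintype.card c.Node c.fintypeNode

/-- The circuit computes `f` at its root. By acyclicity the polynomials `val v` computed at
the nodes are uniquely determined. -/
def Computes (c : Circuit S) (f : MvPolynomial ℕ K) : Prop :=
  ∃ val : c.Node → MvPolynomial ℕ K, (∀ v, val v = (c.gate v).value val) ∧ val c.root = f

/-- A circuit is skew if each multiplication gate has a leaf among its two inputs. -/
def IsSkew (c : Circuit S) : Prop :=
  ∀ v a b, c.gate v = Gate.mul a b → (c.gate a).IsLeaf ∨ (c.gate b).IsLeaf

end Circuit

/-- Formulas: circuits whose underlying graph is a rooted tree. -/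
inductive Formula (K : Type u) : Type u
  | var (i : ℕ) : Formula K
  | const (c : K) : Formula K
  | add (φ ψ : Formula K) : Formula K
  | mul (φ ψ : Formula K) : Formula K

namespace Formula

variable {K : Type u}

/-- The number of nodes. -/
def size : Formula K → ℕ
  | var _ => 1
  | const _ => 1
  | add φ ψ => φ.size + ψ.size + 1
  | mul φ ψ => φ.size + ψ.size + 1

/-- The polynomial computed by a formula. -/
noncomputable def eval [Field K] : Formula K → MvPolynomial ℕ K
  | var i => X i
  | const c => C c
  | add φ ψ => φ.eval + ψ.eval
  | mul φ ψ => φ.eval * ψ.eval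

end Formula

/-! ### Projections and oracle complexity -/

/-- `f ≤ g`: `f` arises from `g` by substituting variables and constants for the variables. -/
def IsProjection {K : Type u} [Field K] (f g : MvPolynomial ℕ K) : Prop :=
  ∃ α : ℕ → MvPolynomial ℕ K,
    (∀ i, (∃ j, α i = X j) ∨ (∃ c, α i = C c)) ∧ f = aeval α g

/-- `L^g(f) ≤ s`: some circuit of size at most `s` with `g`-oracle gates computes `f`. -/
def OracleComplexityLE {K : Type u} [Field K] (g f : MvPolynomial ℕ K) (s : ℕ) : Prop :=
  ∃ c : Circuit ({g} : Set (MvPolynomial ℕ K)), c.Computes f ∧ c.size ≤ s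

/-- A polynomial over `K`, viewed over `K(ε)`. -/
noncomputable def lift {K : Type u} [Field K] (f : MvPolynomial ℕ K) :
    MvPolynomial ℕ (RatFunc K) :=
  MvPolynomial.map (algebraMap K (RatFunc K)) f

/-- The polynomial `f + ε h` over `K(ε)`, for `f` over `K` and `h` over `K[ε]`. -/
noncomputable def perturb {K : Type u} [Field K] (f : MvPolynomial ℕ K)
    (h : MvPolynomial ℕ (Polynomial K)) : MvPolynomial ℕ (RatFunc K) :=
  lift f + C RatFunc.X * MvPolynomial.map (algebraMap (Polynomial K) (RatFunc K)) h

/-! ### The four reduction notions -/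

section Reductions

variable {K : Type u} [Field K]

/-- `(f) ≤_p (g)`. -/
def PProjection (f g : Family K) : Prop :=
  ∃ t : ℕ → ℕ, PolyBounded t ∧ ∀ n, IsProjection (f n) (g (t n))

/-- `(f) ≤_c (g)`. -/
def CReduction (f g : Family K) : Prop :=
  ∃ t : ℕ → ℕ, PolyBounded t ∧ ∃ s : ℕ → ℕ, PolyBounded s ∧
    ∀ n, OracleComplexityLE (g (t n)) (f n) (s n)

/-- `(f) ⊴_p (g)`. -/
def BorderPProjection (f g : Family K) : Prop :=
  ∃ t : ℕ → ℕ, PolyBounded t ∧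
    ∀ n, ∃ h : MvPolynomial ℕ (Polynomial K), IsProjection (perturb (f n) h) (lift (g (t n)))

/-- `(f) ⊴_c (g)`. -/
def BorderCReduction (f g : Family K) : Prop :=
  ∃ t : ℕ → ℕ, PolyBounded t ∧ ∃ s : ℕ → ℕ, PolyBounded s ∧
    ∀ n, ∃ h : MvPolynomial ℕ (Polynomial K),
      OracleComplexityLE (lift (g (t n))) (perturb (f n) h) (s n)

end Reductions

/-- The four kinds of reductions. -/
inductive ReductionKind
  | p
  | c
  | borderP
  | borderC

/-- `Reduces r f g`: the family `f` reduces to the family `g` under the reduction notion `r`. -/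
def Reduces {K : Type u} [Field K] : ReductionKind → Family K → Family K → Prop
  | .p => PProjection
  | .c => CReduction
  | .borderP => BorderPProjection
  | .borderC => BorderCReduction

/-! ### Complexity classes, for every field at once -/

/-- A complexity class assigns to every field a set of families over this field. -/
abbrev ComplexityClass : Type (u + 1) := ∀ (K : Type u) [Field K], Set (Family K)

/-- p-families with circuits of polynomially bounded size. -/
def VP : ComplexityClass.{u} := fun K _ =>
  {f | IsPFamily f ∧ ∃ s : ℕ → ℕ, PolyBounded s ∧
    ∀ n, ∃ c : Circuit (∅ : Set (MvPolynomial ℕ K)), c.Computes (f n) ∧ c.size ≤ s n}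

/-- p-families with skew circuits of polynomially bounded size. -/
def VBP : ComplexityClass.{u} := fun K _ =>
  {f | IsPFamily f ∧ ∃ s : ℕ → ℕ, PolyBounded s ∧
    ∀ n, ∃ c : Circuit (∅ : Set (MvPolynomial ℕ K)),
      c.IsSkew ∧ c.Computes (f n) ∧ c.size ≤ s n}

/-- p-families with formulas of polynomially bounded size. -/
def VF : ComplexityClass.{u} := fun K _ =>
  {f | IsPFamily f ∧ ∃ s : ℕ → ℕ, PolyBounded s ∧
    ∀ n, ∃ φ : Formula K, φ.eval = f n ∧ φ.size ≤ s n}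

open Classical in
/-- The Hamiltonian cycle family: the sum over all cyclic permutations `π` of `n` symbols of the
products `x_{1,π(1)} ⋯ x_{n,π(n)}`. The variable `x_{i,j}` has index `Nat.pair i j`. -/
noncomputable def HC (K : Type u) [Field K] : Family K := fun n =>
  ∑ π ∈ Finset.univ.filter (fun π : Equiv.Perm (Fin n) => π.IsCycleOn Set.univ),
    ∏ i : Fin n, X (Nat.pair i (π i))

/-- p-families that are p-projections of the Hamiltonian cycle family. -/
def VNP : ComplexityClass.{u} := fun K _ => {f | IsPFamily f ∧ PProjection f (HC K)}

/-- The families in VNP to which the Hamiltonian cycle family reduces under `r`. -/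
def VNPC (r : ReductionKind) : ComplexityClass.{u} := fun K _ =>
  {f | f ∈ VNP K ∧ Reduces r (HC K) f}

/-- The families in `A` to which every family in `A` reduces under `r`. -/
def Complete (A : ComplexityClass.{u}) (r : ReductionKind) : ComplexityClass.{u} := fun K _ =>
  {f | f ∈ A K ∧ ∀ g ∈ A K, Reduces r g f}

/-- The difference of two complexity classes, over every field. -/
def Diff (A B : ComplexityClass.{u}) : ComplexityClass.{u} := fun K _ => A K \ B K

/-- The border closure of `A` over `K`: the p-families `(f)` over `K` such that `(f) + ε (g)` lies
in `A` over `K(ε)` for some p-family `(g)` over `K[ε]`. -/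
def borderClosure (A : ComplexityClass.{u}) : ComplexityClass.{u} := fun K _ =>
  {f | IsPFamily f ∧ ∃ g : Family (Polynomial K), IsPFamily g ∧
    (fun n => perturb (f n) (g n)) ∈ A (RatFunc K)}

/-- Over `K`, the class `A` is a dense subset of the class `B`: it is contained in `B`, and every
element of `B` lies in the border closure of `A`. -/
def IsDenseIn (A B : ComplexityClass.{u}) (K : Type u) [Field K] : Prop :=
  A K ⊆ B K ∧ B K ⊆ borderClosure A K

end AlgComplexity

namespace AlgComplexity

/-! ### Polynomially bounded sequences -/

/-! Over `K(ε)` the constant `1/ε` may be substituted, so a summand multiplied by `ε` can be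
amplified and the unperturbed part cancelled. A `p`-projection is a reduction of all four kinds
(`PProjection.reduces`), so completeness only has to be shown for `p`-projections.

For VF, VBP and VP, let `U` be a family with integer coefficients that is complete under
`p`-projections over every field. With fresh variables, `f + ε (y U + z)` is a perturbation of `f`.
Setting the variables of `f` to `0`, `y` to `1/ε` and `z` to `-f(0)/ε` recovers `U`
(`isDenseIn_complete`). The universal families are generic computations: Brent's depth reduction for
formulas, a generic skew straight-line program, and for circuits a generic program that computes
homogeneous components separately, which keeps its degree polynomial.

Incompleteness under `p`-projections is witnessed by a single variable, which has minimal
complexity. Adding `ε` times a sum of high powers of the variables of `f`, with distinct exponents,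
yields a polynomial that does not project to a variable (`isDenseIn_diff_complete`).

For VNP, `f` is written as a Hamiltonian cycle sum, and the edge weights are perturbed instead of
the sum. A gadget of two vertices adds a product of three simple factors to one weight
(`hamiltonSum_gadget`), so the perturbation stays in VNP. Weights `M + ε y w + ε v` with fresh `y,
w, v` project to the Hamiltonian cycle polynomial by the same cancellation. Replacing each variable
`x` by `x + ε x²` forces even degree on every univariate projection, which excludes a variable. -/

theorem eval_natPolynomial_mono (p : Polynomial ℕ) : Monotone (fun n : ℕ => p.eval n) := by
  intro a b h
  simp only [Polynomial.eval_eq_sum, Polynomial.sum]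
  gcongr

namespace PolyBounded

theorem mono {s t : ℕ → ℕ} (h : PolyBounded t) (hst : ∀ n, s n ≤ t n) : PolyBounded s := by
  obtain ⟨p, hp⟩ := h
  exact ⟨p, fun n => (hst n).trans (hp n)⟩

theorem const (c : ℕ) : PolyBounded (fun _ => c) := ⟨Polynomial.C c, by simp⟩

theorem id : PolyBounded (fun n => n) := ⟨Polynomial.X, by simp⟩

theorem add {s t : ℕ → ℕ} (hs : PolyBounded s) (ht : PolyBounded t) :
    PolyBounded (fun n => s n + t n) := by
  obtain ⟨p, hp⟩ := hs
  obtain ⟨q, hq⟩ := ht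
  exact ⟨p + q, fun n => by simpa using add_le_add (hp n) (hq n)⟩

theorem mul {s t : ℕ → ℕ} (hs : PolyBounded s) (ht : PolyBounded t) :
    PolyBounded (fun n => s n * t n) := by
  obtain ⟨p, hp⟩ := hs
  obtain ⟨q, hq⟩ := ht
  exact ⟨p * q, fun n => by simpa using Nat.mul_le_mul (hp n) (hq n)⟩

theorem pow {s : ℕ → ℕ} (hs : PolyBounded s) (k : ℕ) : PolyBounded (fun n => s n ^ k) := by
  induction k with
  | zero => simpa using const 1
  | succ k ih => simpa [pow_succ] using ih.mul hs

theorem max {s t : ℕ → ℕ} (hs : PolyBounded s) (ht : PolyBounded t) :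
    PolyBounded (fun n => Max.max (s n) (t n)) :=
  (hs.add ht).mono fun n => by omega

theorem comp {s t : ℕ → ℕ} (hs : PolyBounded s) (ht : PolyBounded t) :
    PolyBounded (fun n => s (t n)) := by
  obtain ⟨p, hp⟩ := hs
  obtain ⟨q, hq⟩ := ht
  refine ⟨p.comp q, fun n => (hp _).trans ?_⟩
  simpa [Polynomial.eval_comp] using eval_natPolynomial_mono p (hq n)

end PolyBounded

/-! ### p-families -/

section PFamily

variable {R : Type u} [CommRing R]

theorem vars_card_add_le (p q : MvPolynomial ℕ R) :
    (p + q).vars.card ≤ p.vars.card + q.vars.card := by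
  classical
  exact (Finset.card_le_card (vars_add_subset p q)).trans (Finset.card_union_le _ _)

theorem vars_card_mul_le (p q : MvPolynomial ℕ R) :
    (p * q).vars.card ≤ p.vars.card + q.vars.card := by
  classical
  exact (Finset.card_le_card (vars_mul p q)).trans (Finset.card_union_le _ _)

theorem vars_card_X_le (i : ℕ) : (X i : MvPolynomial ℕ R).vars.card ≤ 1 := by
  rcases subsingleton_or_nontrivial R with h | h
  · rw [Subsingleton.elim (X i : MvPolynomial ℕ R) 0]
    simp
  · simp

theorem totalDegree_X_le (i : ℕ) : (X i : MvPolynomial ℕ R).totalDegree ≤ 1 := by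
  rcases subsingleton_or_nontrivial R with h | h
  · rw [Subsingleton.elim (X i : MvPolynomial ℕ R) 0]
    simp
  · simp

namespace IsPFamily

theorem add {f g : Family R} (hf : IsPFamily f) (hg : IsPFamily g) :
    IsPFamily (fun n => f n + g n) :=
  ⟨(hf.1.add hg.1).mono fun _ => vars_card_add_le _ _,
    (hf.2.max hg.2).mono fun _ => totalDegree_add _ _⟩

theorem mul {f g : Family R} (hf : IsPFamily f) (hg : IsPFamily g) :
    IsPFamily (fun n => f n * g n) :=
  ⟨(hf.1.add hg.1).mono fun _ => vars_card_mul_le _ _,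
    (hf.2.add hg.2).mono fun _ => totalDegree_mul _ _⟩

theorem var (i : ℕ → ℕ) : IsPFamily (fun n => (X (i n) : MvPolynomial ℕ R)) :=
  ⟨(PolyBounded.const 1).mono fun _ => vars_card_X_le _,
    (PolyBounded.const 1).mono fun _ => totalDegree_X_le _⟩

theorem const (c : ℕ → R) : IsPFamily (fun n => (C (c n) : MvPolynomial ℕ R)) :=
  ⟨(PolyBounded.const 0).mono fun _ => by simp, (PolyBounded.const 0).mono fun _ => by simp⟩

theorem rename {f : Family R} (hf : IsPFamily f) (φ : ℕ → ℕ → ℕ) :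
    IsPFamily (fun n => MvPolynomial.rename (φ n) (f n)) := by
  classical
  exact ⟨hf.1.mono fun n => (Finset.card_le_card (vars_rename _ _)).trans Finset.card_image_le,
    hf.2.mono fun _ => totalDegree_rename_le _ _⟩

theorem of_support {f g : Family R} {S : Type u} [CommRing S] {k : Family S}
    (hf : IsPFamily f) (hk : IsPFamily k)
    (h : ∀ n, (g n).support ⊆ (f n).support ∪ (k n).support) : IsPFamily g := by
  classical
  refine ⟨(hf.1.add hk.1).mono fun n => ?_, (hf.2.max hk.2).mono fun n => ?_⟩
  · refine (Finset.card_le_card ?_).trans (Finset.card_union_le (f n).vars (k n).vars)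
    intro i hi
    obtain ⟨d, hd, hid⟩ := (mem_vars_iff_mem_support i).1 hi
    rcases Finset.mem_union.1 (h n hd) with hd | hd
    · exact Finset.mem_union_left _ ((mem_vars_iff_mem_support i).2 ⟨d, hd, hid⟩)
    · exact Finset.mem_union_right _ ((mem_vars_iff_mem_support i).2 ⟨d, hd, hid⟩)
  · refine Finset.sup_le fun d hd => ?_
    rcases Finset.mem_union.1 (h n hd) with hd | hd
    · exact (le_totalDegree hd).trans (le_max_left _ _)
    · exact (le_totalDegree hd).trans (le_max_right _ _)

theorem map {S : Type u} [CommRing S] (φ : R →+* S) {f : Family R} (hf : IsPFamily f) :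
    IsPFamily (fun n => MvPolynomial.map φ (f n)) := by
  classical
  exact ⟨hf.1.mono fun n => Finset.card_le_card (vars_map _ φ),
    hf.2.mono fun n => by
      exact Finset.sup_le fun d hd => le_totalDegree (support_map_subset _ _ hd)⟩

end IsPFamily

end PFamily

/-! ### Perturbations -/

section Perturb

variable {K : Type u} [Field K]

/-- Polynomials over `K[ε]`, viewed over `K(ε)`. -/
noncomputable abbrev toRat : MvPolynomial ℕ (Polynomial K) →+* MvPolynomial ℕ (RatFunc K) :=
  MvPolynomial.map (algebraMap (Polynomial K) (RatFunc K))

theorem toRat_map_C (f : MvPolynomial ℕ K) :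
    toRat (MvPolynomial.map Polynomial.C f) = lift f := by
  rw [toRat, lift, MvPolynomial.map_map]
  congr 1

/-- A polynomial over `K[ε]` that specializes to `f` at `ε = 0` is a perturbation of `f`. -/
theorem exists_perturb_eq {f : MvPolynomial ℕ K} {F : MvPolynomial ℕ (Polynomial K)}
    (h : MvPolynomial.map Polynomial.constantCoeff F = f) : ∃ g, toRat F = perturb f g := by
  have hd : (C Polynomial.X : MvPolynomial ℕ (Polynomial K)) ∣
      F - MvPolynomial.map Polynomial.C f := by
    rw [C_dvd_iff_dvd_coeff]
    intro i
    rw [Polynomial.X_dvd_iff, coeff_sub, coeff_map, Polynomial.coeff_sub, ← h, coeff_map]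
    simp
  obtain ⟨g, hg⟩ := hd
  refine ⟨g, ?_⟩
  rw [perturb, ← toRat_map_C, sub_eq_iff_eq_add.1 hg, map_add, map_mul, add_comm]
  simp [toRat]

/-- Multiplication by `ε` kills no coefficient: a monomial of `g` that does not occur in `f`
survives in the perturbation. Hence only the perturbed family has to be bounded. -/
theorem IsPFamily.of_perturb {f : Family K} {g : Family (Polynomial K)} (hf : IsPFamily f)
    (h : IsPFamily (fun n => perturb (f n) (g n))) : IsPFamily g := by
  classical
  refine IsPFamily.of_support (f := fun n => MvPolynomial.map Polynomial.C (f n))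
    (hf.map Polynomial.C) h fun n d hd => ?_
  by_contra hcon
  rw [Finset.mem_union, not_or, mem_support_iff, mem_support_iff, not_not, not_not] at hcon
  obtain ⟨h1, h2⟩ := hcon
  rw [coeff_map, map_eq_zero_iff _ Polynomial.C_injective] at h1
  rw [perturb, coeff_add, lift, coeff_map, h1, map_zero, zero_add, coeff_C_mul, coeff_map] at h2
  rcases mul_eq_zero.1 h2 with h2 | h2
  · exact RatFunc.X_ne_zero h2
  · exact mem_support_iff.1 hd ((map_eq_zero_iff _ (RatFunc.algebraMap_injective K)).1 h2)

end Perturb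

/-! ### Projections and reductions -/

section Projection

variable {K : Type u} [Field K]

/-- Variables and constants. -/
def IsSimple (p : MvPolynomial ℕ K) : Prop := (∃ j, p = X j) ∨ (∃ c, p = C c)

theorem isSimple_X (j : ℕ) : IsSimple (X j : MvPolynomial ℕ K) := Or.inl ⟨j, rfl⟩
theorem isSimple_C (c : K) : IsSimple (C c : MvPolynomial ℕ K) := Or.inr ⟨c, rfl⟩
theorem isSimple_zero : IsSimple (0 : MvPolynomial ℕ K) := Or.inr ⟨0, by simp⟩
theorem isSimple_one : IsSimple (1 : MvPolynomial ℕ K) := Or.inr ⟨1, by simp⟩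

theorem IsSimple.aeval {p : MvPolynomial ℕ K} (hp : IsSimple p) {α : ℕ → MvPolynomial ℕ K}
    (hα : ∀ i, IsSimple (α i)) : IsSimple (aeval α p) := by
  rcases hp with ⟨j, rfl⟩ | ⟨c, rfl⟩
  · simpa using hα j
  · exact Or.inr ⟨c, by simp [algebraMap_eq]⟩

theorem IsSimple.map {L : Type u} [Field L] (φ : K →+* L) {p : MvPolynomial ℕ K}
    (hp : IsSimple p) : IsSimple (MvPolynomial.map φ p) := by
  rcases hp with ⟨j, rfl⟩ | ⟨c, rfl⟩
  · exact Or.inl ⟨j, by simp⟩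
  · exact Or.inr ⟨φ c, by simp⟩

theorem IsSimple.rename (φ : ℕ → ℕ) {p : MvPolynomial ℕ K} (hp : IsSimple p) :
    IsSimple (MvPolynomial.rename φ p) := by
  rcases hp with ⟨j, rfl⟩ | ⟨c, rfl⟩
  · exact Or.inl ⟨φ j, by simp⟩
  · exact Or.inr ⟨c, by simp⟩

theorem IsSimple.vars_card_le {p : MvPolynomial ℕ K} (hp : IsSimple p) : p.vars.card ≤ 1 := by
  rcases hp with ⟨j, rfl⟩ | ⟨c, rfl⟩ <;> simp

theorem IsSimple.totalDegree_le {p : MvPolynomial ℕ K} (hp : IsSimple p) :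
    p.totalDegree ≤ 1 := by
  rcases hp with ⟨j, rfl⟩ | ⟨c, rfl⟩ <;> simp

theorem isProjection_iff {f g : MvPolynomial ℕ K} :
    IsProjection f g ↔ ∃ α : ℕ → MvPolynomial ℕ K, (∀ i, IsSimple (α i)) ∧ f = aeval α g :=
  Iff.rfl

theorem aeval_aeval (α β : ℕ → MvPolynomial ℕ K) (f : MvPolynomial ℕ K) :
    aeval α (aeval β f) = aeval (fun i => aeval α (β i)) f := by
  rw [← AlgHom.comp_apply, comp_aeval]

theorem aeval_eq_C_constantCoeff (p : MvPolynomial ℕ K) (α : ℕ → MvPolynomial ℕ K)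
    (h : ∀ i ∈ p.vars, α i = 0) : aeval α p = C (constantCoeff p) := by
  have : aeval α p = aeval (fun _ => (0 : MvPolynomial ℕ K)) p :=
    eval₂Hom_congr' rfl (fun i hi _ => h i hi) rfl
  rw [this, aeval_zero']
  rfl

theorem IsProjection.trans {f g h : MvPolynomial ℕ K} (h₁ : IsProjection f g)
    (h₂ : IsProjection g h) : IsProjection f h := by
  rw [isProjection_iff] at *
  obtain ⟨α, hα, rfl⟩ := h₁
  obtain ⟨β, hβ, rfl⟩ := h₂
  exact ⟨fun i => aeval α (β i), fun i => (hβ i).aeval hα, aeval_aeval _ _ _⟩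

theorem PProjection.trans {f g h : Family K} (h₁ : PProjection f g) (h₂ : PProjection g h) :
    PProjection f h := by
  obtain ⟨t, ht, h₁⟩ := h₁
  obtain ⟨s, hs, h₂⟩ := h₂
  exact ⟨fun n => s (t n), hs.comp ht, fun n => (h₁ n).trans (h₂ _)⟩

theorem map_aeval {L : Type*} [Field L] (φ : K →+* L) (α : ℕ → MvPolynomial ℕ K)
    (g : MvPolynomial ℕ K) :
    MvPolynomial.map φ (aeval α g) =
      aeval (fun i => MvPolynomial.map φ (α i)) (MvPolynomial.map φ g) := by
  induction g using MvPolynomial.induction_on with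
  | C a => simp [algebraMap_eq]
  | add p q hp hq => rw [map_add, map_add, map_add, map_add, hp, hq]
  | mul_X p n hp => rw [map_mul, map_mul, map_mul, map_mul, hp, aeval_X, map_X, aeval_X]

theorem IsProjection.lift {f g : MvPolynomial ℕ K} (h : IsProjection f g) :
    IsProjection (lift f) (lift g) := by
  rw [isProjection_iff] at *
  obtain ⟨α, hα, rfl⟩ := h
  exact ⟨fun i => AlgComplexity.lift (α i), fun i => (hα i).map _, map_aeval _ _ _⟩

/-- A projection is computed by a circuit with a single oracle gate. -/
theorem IsProjection.oracleComplexityLE {f g : MvPolynomial ℕ K} (h : IsProjection f g) :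
    OracleComplexityLE g f (g.vars.card + 1) := by
  classical
  rw [isProjection_iff] at h
  obtain ⟨α, hα, rfl⟩ := h
  have hleaf : ∀ i, ∃ γ : Gate ({g} : Set (MvPolynomial ℕ K)) (Option g.vars),
      (∀ v, ¬ γ.HasInput v) ∧ ∀ val, γ.value val = α i := by
    intro i
    rcases hα i with ⟨j, hj⟩ | ⟨c, hc⟩
    · exact ⟨.var j, by simp [Gate.HasInput], by simp [Gate.value, hj]⟩
    · exact ⟨.const c, by simp [Gate.HasInput], by simp [Gate.value, hc]⟩
  choose γ hγ hγv using hleaf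
  let gate : Option g.vars → Gate ({g} : Set (MvPolynomial ℕ K)) (Option g.vars) := fun o =>
    match o with
    | some i => γ i
    | none => .oracle g rfl some
  have hleaf (i : g.vars) : Acc (fun a b => (gate b).HasInput a) (some i) :=
    ⟨_, fun y hy => absurd hy (hγ i y)⟩
  let c : Circuit ({g} : Set (MvPolynomial ℕ K)) :=
    { Node := Option g.vars
      fintypeNode := inferInstance
      gate := gate
      acyclic := by
        refine ⟨fun o => ?_⟩
        rcases o with _ | i
        · refine ⟨_, fun y hy => ?_⟩
          obtain ⟨i, rfl⟩ : ∃ i, y = some i := hy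
          exact hleaf i
        · exact hleaf i
      root := none }
  refine ⟨c, ⟨fun o => o.elim (aeval α g) (fun i => α i), ?_, rfl⟩, ?_⟩
  · rintro (_ | i)
    · change aeval α g = aeval (fun i : ℕ => if h : i ∈ g.vars then _ else 0) g
      -- The default value `0` of the oracle gate concerns only variables that do not occur in `g`.
      refine eval₂Hom_congr' rfl (fun i hi _ => ?_) rfl
      simp [hi]
    · exact (hγv i _).symm
  · simp [Circuit.size, c]

theorem perturb_zero (f : MvPolynomial ℕ K) : perturb f 0 = lift f := by
  simp [perturb]

/-- The border versions hold with error `h = 0`. That `g` is a p-family bounds the number of leaves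
feeding the single oracle gate. -/
theorem PProjection.reduces {f g : Family K} (h : PProjection f g) (hg : IsPFamily g)
    (r : ReductionKind) : Reduces r f g := by
  obtain ⟨t, ht, hp⟩ := h
  have hs : PolyBounded (fun n => (g (t n)).vars.card + 1) :=
    (hg.1.comp ht).add (PolyBounded.const 1)
  cases r with
  | p => exact ⟨t, ht, hp⟩
  | c => exact ⟨t, ht, _, hs, fun n => (hp n).oracleComplexityLE⟩
  | borderP => exact ⟨t, ht, fun n => ⟨0, by rw [perturb_zero]; exact (hp n).lift⟩⟩
  | borderC =>
    refine ⟨t, ht, _, hs, fun n => ⟨0, ?_⟩⟩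
    rw [perturb_zero]
    obtain ⟨c, hc, hle⟩ := (hp n).lift.oracleComplexityLE
    exact ⟨c, hc, hle.trans (Nat.succ_le_succ (Finset.card_le_card (vars_map _ _)))⟩

end Projection

/-! ### Classes defined by complexity measures -/

/-- Closure properties of a complexity measure, given as the relation "`p` has complexity at most
`n`", which suffice to perturb polynomials. -/
structure IsMeasure (Cx : ∀ (K : Type u) [Field K], MvPolynomial ℕ K → ℕ → Prop) : Prop where
  mono : ∀ {K : Type u} [Field K] {p : MvPolynomial ℕ K} {a b : ℕ}, Cx K p a → a ≤ b → Cx K p b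
  simple : ∀ {K : Type u} [Field K] {p : MvPolynomial ℕ K}, IsSimple p → Cx K p 1
  add : ∀ {K : Type u} [Field K] {p q : MvPolynomial ℕ K} {a b : ℕ},
    Cx K p a → Cx K q b → Cx K (p + q) (a + b + 1)
  -- Only multiplication by a variable or constant is required, since this is all that skew circuits
  -- support. The cost `2` pays for the leaf and the product.
  mul : ∀ {K : Type u} [Field K] {p q : MvPolynomial ℕ K} {a : ℕ},
    IsSimple q → Cx K p a → Cx K (q * p) (a + 2)
  rename : ∀ {K : Type u} [Field K] {p : MvPolynomial ℕ K} {a : ℕ} (φ : ℕ → ℕ),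
    Cx K p a → Cx K (MvPolynomial.rename φ p) a
  map : ∀ {K L : Type u} [Field K] [Field L] {p : MvPolynomial ℕ K} {a : ℕ} (φ : K →+* L),
    Cx K p a → Cx L (MvPolynomial.map φ p) a

/-- The p-families of polynomially bounded complexity. -/
def classOf (Cx : ∀ (K : Type u) [Field K], MvPolynomial ℕ K → ℕ → Prop) :
    ComplexityClass.{u} := fun K _ =>
  {f | IsPFamily f ∧ ∃ s : ℕ → ℕ, PolyBounded s ∧ ∀ n, Cx K (f n) (s n)}

variable {Cx : ∀ (K : Type u) [Field K], MvPolynomial ℕ K → ℕ → Prop}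

theorem IsMeasure.pow_var (h : IsMeasure Cx) {K : Type u} [Field K] (i k : ℕ) :
    Cx K (X i ^ k) (2 * k + 1) := by
  induction k with
  | zero => simpa using h.simple isSimple_one
  | succ k ih =>
    rw [pow_succ']
    exact h.mono (h.mul (isSimple_X i) ih) (by omega)

theorem IsMeasure.sum (h : IsMeasure Cx) {K : Type u} [Field K] (s : Finset ℕ)
    (p : ℕ → MvPolynomial ℕ K) (N : ℕ) (hp : ∀ i ∈ s, Cx K (p i) N) :
    Cx K (∑ i ∈ s, p i) (s.card * (N + 1) + 1) := by
  classical
  induction s using Finset.induction_on with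
  | empty => simpa using h.simple isSimple_zero
  | insert a s ha ih =>
    rw [Finset.sum_insert ha, Finset.card_insert_of_notMem ha]
    refine h.mono (h.add (hp a (by simp)) (ih fun i hi => hp i (by simp [hi]))) ?_
    rw [add_mul]
    omega

/-! ### Perturbations for an arbitrary complexity measure -/

section Density

variable {K : Type u} [Field K]

/-- The perturbing power sum: pairwise distinct exponents starting at `D`. -/
noncomputable def powerSum (R : Type u) [CommRing R] (s : Finset ℕ) (D : ℕ) (r : ℕ → ℕ) :
    MvPolynomial ℕ R := ∑ i ∈ s, X i ^ (D + r i)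

theorem powerSum_vars_card (R : Type u) [CommRing R] (s : Finset ℕ) (D : ℕ) (r : ℕ → ℕ) :
    (powerSum R s D r).vars.card ≤ s.card := by
  classical
  refine Finset.card_le_card ((vars_sum_subset _ _).trans ?_)
  refine Finset.biUnion_subset.2 fun i hi => (vars_pow _ _).trans ?_
  rcases subsingleton_or_nontrivial R with hR | hR
  · rw [Subsingleton.elim (X i : MvPolynomial ℕ R) 0]
    simp
  · simpa using hi

theorem powerSum_totalDegree (R : Type u) [CommRing R] (s : Finset ℕ) (D N : ℕ) (r : ℕ → ℕ)
    (hr : ∀ i ∈ s, r i < N) : (powerSum R s D r).totalDegree ≤ D + N := by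
  refine (totalDegree_finsetSum _ _).trans (Finset.sup_le fun i hi => ?_)
  refine (totalDegree_pow _ _).trans ?_
  have := hr i hi
  calc (D + r i) * (X i : MvPolynomial ℕ R).totalDegree ≤ (D + r i) * 1 :=
        Nat.mul_le_mul_left _ (totalDegree_X_le i)
    _ ≤ D + N := by omega

theorem toRat_powerSum (s : Finset ℕ) (D : ℕ) (r : ℕ → ℕ) :
    toRat (powerSum (Polynomial K) s D r) = powerSum (RatFunc K) s D r := by
  simp [powerSum]

theorem IsSimple.aeval_eq_X_or_C {p : MvPolynomial ℕ K} (hp : IsSimple p)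
    (ρ : ℕ → Polynomial K) (hρ : ∀ i, ρ i = Polynomial.X ∨ ∃ c, ρ i = Polynomial.C c) :
    MvPolynomial.aeval ρ p = Polynomial.X ∨ ∃ c, MvPolynomial.aeval ρ p = Polynomial.C c := by
  rcases hp with ⟨j, rfl⟩ | ⟨c, rfl⟩
  · simpa using hρ j
  · exact Or.inr ⟨c, by simp [Polynomial.algebraMap_eq]⟩

/-- A polynomial plus a sum of high powers of its variables, with distinct exponents, does not
project to a variable. -/
theorem not_isProjection_add_powerSum (f : MvPolynomial ℕ K) (e : K) (he : e ≠ 0) (D : ℕ)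
    (hD : f.totalDegree < D) (hD2 : 2 ≤ D) (r : ℕ → ℕ) (hr : Set.InjOn r f.vars) :
    ¬ IsProjection (X 0) (f + C e * powerSum K f.vars D r) := by
  classical
  rw [isProjection_iff]
  rintro ⟨α, hα, h⟩
  -- Identifying all variables turns the projection into a univariate identity, in which each
  -- variable becomes `X` or a constant.
  set γ : ℕ → Polynomial K := fun i => aeval (fun _ => Polynomial.X) (α i) with hγdef
  have hγ : ∀ i, γ i = Polynomial.X ∨ ∃ c, γ i = Polynomial.C c := fun i =>
    IsSimple.aeval_eq_X_or_C (hα i) _ fun _ => Or.inl rfl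
  have h' : (Polynomial.X : Polynomial K) =
      aeval γ f + Polynomial.C e * ∑ i ∈ f.vars, γ i ^ (D + r i) := by
    have := congrArg (aeval (fun _ : ℕ => (Polynomial.X : Polynomial K))) h
    rw [← AlgHom.comp_apply, comp_aeval, aeval_X] at this
    rw [this, map_add, map_mul, powerSum, map_sum]
    simp [hγdef, Polynomial.algebraMap_eq]
  -- If a variable `i₀` of `f` becomes `X`, the coefficient of `X ^ (D + r i₀)` is compared: `f` has
  -- too small a degree to contribute, the other powers have different exponents or are constant, so
  -- `e` would be zero.
  by_cases hcase : ∃ i ∈ f.vars, γ i = Polynomial.X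
  · obtain ⟨i₀, hi₀, hX⟩ := hcase
    have hc := congrArg (fun p => Polynomial.coeff p (D + r i₀)) h'
    simp only [Polynomial.coeff_add, Polynomial.coeff_C_mul, Polynomial.finsetSum_coeff] at hc
    have hdeg : (aeval γ f).natDegree ≤ f.totalDegree * 1 :=
      aeval_natDegree_le f le_rfl γ fun i => by
        rcases hγ i with h | ⟨c, h⟩ <;> simp [h]
    rw [Polynomial.coeff_eq_zero_of_natDegree_lt (p := aeval γ f) (by omega),
      Polynomial.coeff_X_of_ne_one (by omega), zero_add, Finset.sum_eq_single i₀] at hc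
    · rw [hX, Polynomial.coeff_X_pow, if_pos rfl, mul_one] at hc
      exact he hc.symm
    · intro i hi hne
      rcases hγ i with h | ⟨c, h⟩
      · rw [h, Polynomial.coeff_X_pow, if_neg]
        intro heq
        exact hne (hr hi hi₀ (by omega))
      · rw [h, ← Polynomial.C_pow, Polynomial.coeff_C, if_neg (by omega)]
    · exact fun h => absurd hi₀ h
  -- Otherwise all variables of `f` become constants, and the right-hand side has no linear term.
  · push Not at hcase
    have hcst : ∀ i ∈ f.vars, ∃ c, γ i = Polynomial.C c := fun i hi =>
      (hγ i).resolve_left (hcase i hi)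
    have hf : aeval γ f = aeval (fun i => if i ∈ f.vars then γ i else 0) f :=
      eval₂Hom_congr' rfl (fun i hi _ => by simp [hi]) rfl
    have hdeg : (aeval γ f).natDegree ≤ f.totalDegree * 0 := by
      rw [hf]
      refine aeval_natDegree_le f le_rfl _ fun i => ?_
      split_ifs with hi
      · obtain ⟨c, hc⟩ := hcst i hi
        simp [hc]
      · simp
    have hc := congrArg (fun p => Polynomial.coeff p 1) h'
    simp only [Polynomial.coeff_add, Polynomial.coeff_C_mul, Polynomial.finsetSum_coeff] at hc
    rw [Polynomial.coeff_eq_zero_of_natDegree_lt (p := aeval γ f) (by omega),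
      Polynomial.coeff_X_one, zero_add, Finset.sum_eq_zero] at hc
    · simp at hc
    · intro i hi
      obtain ⟨c, hc⟩ := hcst i hi
      rw [hc, ← Polynomial.C_pow, Polynomial.coeff_C, if_neg (by omega)]

/-- The exponents of the power sum must be distinct but small, so that its degree stays polynomially
bounded. -/
theorem exists_injOn_lt_card (s : Finset ℕ) :
    ∃ r : ℕ → ℕ, Set.InjOn r s ∧ ∀ i ∈ s, r i < s.card := by
  classical
  refine ⟨fun i => if h : i ∈ s then s.equivFin ⟨i, h⟩ else 0, ?_, ?_⟩
  · intro i hi j hj h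
    have hi' : i ∈ s := hi
    have hj' : j ∈ s := hj
    simp only [hi', hj', dif_pos] at h
    simpa using s.equivFin.injective (Fin.ext h)
  · intro i hi
    simp [hi]

theorem lift_vars (f : MvPolynomial ℕ K) : (lift f).vars = f.vars :=
  vars_map_of_injective f (algebraMap K (RatFunc K)).injective

theorem lift_totalDegree_le (f : MvPolynomial ℕ K) :
    (lift f).totalDegree ≤ f.totalDegree :=
  Finset.sup_le fun _ hd => le_totalDegree (support_map_subset _ _ hd)

theorem IsPFamily.perturb {f : Family K} {g : Family (Polynomial K)} (hf : IsPFamily f)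
    (hg : IsPFamily g) : IsPFamily (fun n => AlgComplexity.perturb (f n) (g n)) :=
  (hf.map _).add ((IsPFamily.const _).mul (hg.map _))

/-- The constant family `X 0` lies in the class; if the perturbed family were complete, one of its
members would project to `X 0`. -/
theorem isDenseIn_diff_complete (h : IsMeasure Cx) :
    IsDenseIn (Diff (classOf Cx) (Complete (classOf Cx) .p)) (classOf Cx) K := by
  refine ⟨fun f hf => hf.1, fun f hf => ⟨hf.1, ?_⟩⟩
  obtain ⟨hpf, s, hs, hsf⟩ := hf
  choose r hrinj hrlt using fun n => exists_injOn_lt_card (f n).vars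
  -- The summand `2` makes every exponent exceed the degree of `f` and also differ from `1`, even if
  -- `f` is constant.
  set D : ℕ → ℕ := fun n => (f n).totalDegree + 2 with hD
  have hDb : PolyBounded D := hpf.2.add (.const 2)
  set g : Family (Polynomial K) := fun n => powerSum _ (f n).vars (D n) (r n) with hgdef
  have hg : IsPFamily g := ⟨hpf.1.mono fun n => powerSum_vars_card _ _ _ _,
    (hDb.add hpf.1).mono fun n => powerSum_totalDegree _ _ _ _ _ (hrlt n)⟩
  have hF : ∀ n, perturb (f n) (g n) =
      lift (f n) + C RatFunc.X * powerSum (RatFunc K) (lift (f n)).vars (D n) (r n) := by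
    intro n
    rw [lift_vars, ← toRat_powerSum]
    rfl
  refine ⟨g, hg, ⟨hpf.perturb hg, fun n => s n + ((f n).vars.card *
    (2 * (D n + (f n).vars.card) + 1 + 1) + 1 + 2) + 1, ?_, fun n => ?_⟩, ?_⟩
  · exact (hs.add (((hpf.1.mul ((((PolyBounded.const 2).mul (hDb.add hpf.1)).add
      (.const 1)).add (.const 1))).add (.const 1)).add (.const 2))).add (.const 1)
  · beta_reduce
    rw [hF, lift_vars]
    refine h.add (h.map _ (hsf n)) (h.mul (isSimple_C _) (h.sum _ _
      (2 * (D n + (f n).vars.card) + 1) fun i hi => h.mono (h.pow_var i _) ?_))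
    have := hrlt n i hi
    omega
  · rintro ⟨-, hcomp⟩
    obtain ⟨t, -, ht⟩ := hcomp (fun _ => X 0)
      ⟨IsPFamily.var _, fun _ => 1, .const 1, fun _ => h.simple (isSimple_X 0)⟩
    have := ht 0
    beta_reduce at this
    rw [hF] at this
    refine not_isProjection_add_powerSum _ _ RatFunc.X_ne_zero _ ?_ ?_ _ ?_ this
    · have := lift_totalDegree_le (f (t 0))
      simp only [hD]
      omega
    · simp [hD]
    · rw [lift_vars]
      exact hrinj _

/-- The summand `y U + z` is hidden behind `ε` and uncovered by a substitution involving `1/ε`. The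
model `U'` over `K[ε]` is needed since the error term of a perturbation must not have denominators.
-/
theorem isDenseIn_complete (h : IsMeasure Cx) (U : Family (RatFunc K))
    (U' : Family (Polynomial K)) (hU' : ∀ n, toRat (U' n) = U n)
    (hU : U ∈ classOf Cx (RatFunc K))
    (hcomp : ∀ g ∈ classOf Cx (RatFunc K), PProjection g U) (r : ReductionKind) :
    IsDenseIn (Complete (classOf Cx) r) (classOf Cx) K := by
  refine ⟨fun f hf => hf.1, fun f hf => ⟨hf.1, ?_⟩⟩
  obtain ⟨hpf, s, hs, hsf⟩ := hf
  obtain ⟨hpU, sU, hsU, hsfU⟩ := hU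
  -- All variables of `f n` lie below `M n`, so `y = M n`, `z = M n + 1` and the copy of `U`
  -- starting at `M n + 2` are fresh.
  set M : ℕ → ℕ := fun n => (f n).vars.sup id + 1 with hM
  set g : Family (Polynomial K) := fun n =>
    X (M n) * rename (fun i => M n + 2 + i) (U' n) + X (M n + 1) with hgdef
  have hF : ∀ n, perturb (f n) (g n) = lift (f n) + C RatFunc.X *
      (X (M n) * rename (fun i => M n + 2 + i) (U n) + X (M n + 1)) := by
    intro n
    simp [perturb, hgdef, ← hU', map_rename]
  have hpF : IsPFamily (fun n => perturb (f n) (g n)) := by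
    simp only [hF]
    exact (hpf.map _).add ((IsPFamily.const _).mul
      (((IsPFamily.var _).mul (hpU.rename fun n i => M n + 2 + i)).add (IsPFamily.var _)))
  refine ⟨g, IsPFamily.of_perturb hpf hpF, ⟨hpF, fun n => s n + (sU n + 2 + 1 + 1 + 2) + 1, ?_,
    fun n => ?_⟩, fun G hG => ?_⟩
  · exact (hs.add (((hsU.add (.const 2)).add (.const 1)).add (.const 1) |>.add
      (.const 2))).add (.const 1)
  · beta_reduce
    rw [hF]
    exact h.add (h.map _ (hsf n)) (h.mul (isSimple_C _)
      (h.add (a := sU n + 2) (b := 1) (h.mul (isSimple_X _) (h.rename _ (hsfU n))) (h.simple (isSimple_X _))))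
  · refine PProjection.reduces ((hcomp G hG).trans ⟨fun n => n, .id, fun n => ?_⟩) hpF r
    beta_reduce
    rw [hF, isProjection_iff]
    set a : RatFunc K := constantCoeff (lift (f n)) with ha
    let α : ℕ → MvPolynomial ℕ (RatFunc K) := fun i =>
      if i < M n then 0 else if i = M n then C (RatFunc.X⁻¹) else
        if i = M n + 1 then C (- (RatFunc.X⁻¹ * a)) else X (i - (M n + 2))
    refine ⟨α, fun i => ?_, ?_⟩
    · simp only [α]
      split_ifs
      exacts [isSimple_zero, isSimple_C _, isSimple_C _, isSimple_X _]
    · have h1 : aeval α (lift (f n)) = C a := by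
        refine aeval_eq_C_constantCoeff _ _ fun i hi => ?_
        rw [lift_vars] at hi
        have : i ≤ (f n).vars.sup id := Finset.le_sup (f := id) hi
        exact if_pos (by simp only [hM]; omega)
      have h2 : aeval α (rename (fun i => M n + 2 + i) (U n)) = U n := by
        rw [aeval_rename]
        conv_rhs => rw [← aeval_X_left_apply (U n)]
        congr 2
        funext i
        simp only [Function.comp, α]
        rw [if_neg (by omega), if_neg (by omega), if_neg (by omega)]
        congr 1
        omega
      rw [map_add, map_mul, map_add, map_mul, h1, h2, aeval_X, aeval_X, algHom_C]
      have h3 : α (M n) = C (RatFunc.X⁻¹) := by simp [α]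
      have h4 : α (M n + 1) = C (- (RatFunc.X⁻¹ * a)) := by simp [α]
      have h5 : (C RatFunc.X * C (RatFunc.X⁻¹) : MvPolynomial ℕ (RatFunc K)) = 1 := by
        rw [← C_mul, mul_inv_cancel₀ RatFunc.X_ne_zero, C_1]
      rw [h3, h4, algebraMap_eq, C_neg, C_mul]
      -- This is `a + ε (ε⁻¹ U - ε⁻¹ a) = U`.
      linear_combination (C a - U n) * h5

end Density

/-! ### Formulas -/

/-- Some formula of size at most `n` evaluates to `p`. -/
def FormulaLE (K : Type u) [Field K] (p : MvPolynomial ℕ K) (n : ℕ) : Prop :=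
  ∃ φ : Formula K, φ.eval = p ∧ φ.size ≤ n

theorem VF_eq : (VF.{u} : ComplexityClass.{u}) = classOf FormulaLE := rfl

namespace Formula

variable {K : Type u}

/-- Renaming of variables and mapping of constants. -/
def map {L : Type u} (φ : K → L) (r : ℕ → ℕ) : Formula K → Formula L
  | var i => var (r i)
  | const c => const (φ c)
  | add a b => add (a.map φ r) (b.map φ r)
  | mul a b => mul (a.map φ r) (b.map φ r)

theorem size_map {L : Type u} (φ : K → L) (r : ℕ → ℕ) (a : Formula K) :
    (a.map φ r).size = a.size := by
  induction a <;> simp_all [map, size]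

theorem eval_map [Field K] {L : Type u} [Field L] (φ : K →+* L) (r : ℕ → ℕ) (a : Formula K) :
    (a.map φ r).eval = MvPolynomial.rename r (MvPolynomial.map φ a.eval) := by
  induction a <;> simp_all [map, eval]

/-- The number of operations. -/
def gates : Formula K → ℕ
  | var _ => 0
  | const _ => 0
  | add a b => a.gates + b.gates + 1
  | mul a b => a.gates + b.gates + 1

theorem gates_lt_size (a : Formula K) : a.gates < a.size := by
  induction a <;> simp only [gates, size] <;> omega

theorem vars_card_eval_le [Field K] (a : Formula K) : a.eval.vars.card ≤ a.size := by
  induction a with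
  | var i => exact vars_card_X_le i
  | const c => simp [eval]
  | add a b ha hb => exact (vars_card_add_le _ _).trans (by simp only [size]; omega)
  | mul a b ha hb => exact (vars_card_mul_le _ _).trans (by simp only [size]; omega)

theorem totalDegree_eval_le [Field K] (a : Formula K) : a.eval.totalDegree ≤ a.size := by
  induction a with
  | var i => exact totalDegree_X_le i
  | const c => simp [eval]
  | add a b ha hb => exact (totalDegree_add _ _).trans (by simp only [size]; omega)
  | mul a b ha hb => exact (totalDegree_mul _ _).trans (by simp only [size]; omega)

/-- A balanced subformula `op ψ₁ ψ₂`, together with the contexts obtained by replacing it by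
`0` and `1`. -/
theorem exists_separator [Field K] (N : ℕ) (φ : Formula K) (h : N < φ.gates) :
    ∃ ψ₁ ψ₂ A₀ A₁ : Formula K, ∃ q : MvPolynomial ℕ K,
      (q = ψ₁.eval + ψ₂.eval ∨ q = ψ₁.eval * ψ₂.eval) ∧
      ψ₁.gates ≤ N ∧ ψ₂.gates ≤ N ∧ A₀.gates + N < φ.gates ∧ A₁.gates + N < φ.gates ∧
      φ.eval = (A₁.eval - A₀.eval) * q + A₀.eval := by
  -- If both arguments have at most `N` gates, the whole formula is the separated one, and its
  -- contexts are the constants `0` and `1`.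
  have base : ∀ (ψ₁ ψ₂ φ : Formula K), ψ₁.gates ≤ N → ψ₂.gates ≤ N → N < φ.gates →
      (φ.eval = ψ₁.eval + ψ₂.eval ∨ φ.eval = ψ₁.eval * ψ₂.eval) →
      ∃ ψ₁ ψ₂ A₀ A₁ : Formula K, ∃ q : MvPolynomial ℕ K,
      (q = ψ₁.eval + ψ₂.eval ∨ q = ψ₁.eval * ψ₂.eval) ∧
      ψ₁.gates ≤ N ∧ ψ₂.gates ≤ N ∧ A₀.gates + N < φ.gates ∧ A₁.gates + N < φ.gates ∧
      φ.eval = (A₁.eval - A₀.eval) * q + A₀.eval := fun ψ₁ ψ₂ φ h₁ h₂ h₃ h =>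
    ⟨ψ₁, ψ₂, const 0, const 1, φ.eval, h, h₁, h₂, by simpa [gates] using h₃,
      by simpa [gates] using h₃, by simp [eval]⟩
  induction φ with
  | var i => simp [gates] at h
  | const c => simp [gates] at h
  | add a b ha hb =>
    -- The search descends into an argument with more than `N` gates. The value stays affine linear
    -- in the separated subformula because it occurs only once in the tree.
    by_cases h₁ : N < a.gates
    · obtain ⟨ψ₁, ψ₂, A₀, A₁, q, hq, hψ₁, hψ₂, h₀, h₁, he⟩ := ha h₁
      refine ⟨ψ₁, ψ₂, add A₀ b, add A₁ b, q, hq, hψ₁, hψ₂, ?_, ?_, ?_⟩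
      · simp only [gates]; omega
      · simp only [gates]; omega
      · simp only [eval, he]; ring
    · by_cases h₂ : N < b.gates
      · obtain ⟨ψ₁, ψ₂, A₀, A₁, q, hq, hψ₁, hψ₂, h₀, h₁, he⟩ := hb h₂
        refine ⟨ψ₁, ψ₂, add a A₀, add a A₁, q, hq, hψ₁, hψ₂, ?_, ?_, ?_⟩
        · simp only [gates]; omega
        · simp only [gates]; omega
        · simp only [eval, he]; ring
      · exact base a b _ (not_lt.1 h₁) (not_lt.1 h₂) h (Or.inl rfl)
  | mul a b ha hb =>
    by_cases h₁ : N < a.gates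
    · obtain ⟨ψ₁, ψ₂, A₀, A₁, q, hq, hψ₁, hψ₂, h₀, h₁, he⟩ := ha h₁
      refine ⟨ψ₁, ψ₂, mul A₀ b, mul A₁ b, q, hq, hψ₁, hψ₂, ?_, ?_, ?_⟩
      · simp only [gates]; omega
      · simp only [gates]; omega
      · simp only [eval, he]; ring
    · by_cases h₂ : N < b.gates
      · obtain ⟨ψ₁, ψ₂, A₀, A₁, q, hq, hψ₁, hψ₂, h₀, h₁, he⟩ := hb h₂
        refine ⟨ψ₁, ψ₂, mul a A₀, mul a A₁, q, hq, hψ₁, hψ₂, ?_, ?_, ?_⟩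
        · simp only [gates]; omega
        · simp only [gates]; omega
        · simp only [eval, he]; ring
      · exact base a b _ (not_lt.1 h₁) (not_lt.1 h₂) h (Or.inr rfl)

end Formula

theorem isMeasure_formulaLE : IsMeasure FormulaLE.{u} where
  mono := fun ⟨φ, h, hle⟩ hab => ⟨φ, h, hle.trans hab⟩
  simple := by
    rintro K _ p (⟨j, rfl⟩ | ⟨c, rfl⟩)
    exacts [⟨.var j, rfl, le_rfl⟩, ⟨.const c, rfl, le_rfl⟩]
  add := by
    rintro K _ p q a b ⟨φ, rfl, hφ⟩ ⟨ψ, rfl, hψ⟩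
    exact ⟨.add φ ψ, rfl, by simp only [Formula.size]; omega⟩
  mul := by
    rintro K _ p q a (⟨j, rfl⟩ | ⟨c, rfl⟩) ⟨φ, rfl, hφ⟩
    exacts [⟨.mul (.var j) φ, rfl, by simp only [Formula.size]; omega⟩,
      ⟨.mul (.const c) φ, rfl, by simp only [Formula.size]; omega⟩]
  rename := by
    rintro K _ p a r ⟨φ, rfl, hφ⟩
    exact ⟨φ.map (RingHom.id K) r, by rw [Formula.eval_map, MvPolynomial.map_id],
      by rwa [Formula.size_map]⟩
  map := by
    rintro K L _ _ p a σ ⟨φ, rfl, hφ⟩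
    exact ⟨φ.map σ id, by rw [Formula.eval_map, rename_id]; rfl, by rwa [Formula.size_map]⟩

/-- The universal polynomials for formulas: `T (d + 1) = T d * T d + T d` with disjoint sets of
variables. -/
noncomputable def formulaUniversal (R : Type u) [CommRing R] : ℕ → MvPolynomial ℕ R
  | 0 => X 0
  | d + 1 => rename (fun i => 3 * i) (formulaUniversal R d) *
      rename (fun i => 3 * i + 1) (formulaUniversal R d) +
      rename (fun i => 3 * i + 2) (formulaUniversal R d)

theorem map_formulaUniversal {R S : Type u} [CommRing R] [CommRing S] (φ : R →+* S) (d : ℕ) :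
    map φ (formulaUniversal R d) = formulaUniversal S d := by
  induction d with
  | zero => simp [formulaUniversal]
  | succ d ih => simp [formulaUniversal, map_rename, ih]

section

variable {K : Type u} [Field K]

/-- The bound solves `s (d + 1) = 3 * s d + 2` with `s 0 = 1`. -/
theorem formulaUniversal_formulaLE (d : ℕ) :
    FormulaLE K (formulaUniversal K d) (2 * 3 ^ d - 1) := by
  induction d with
  | zero => exact isMeasure_formulaLE.simple (isSimple_X 0)
  | succ d ih =>
    obtain ⟨a, ha, hale⟩ := isMeasure_formulaLE.rename (fun i => 3 * i) ih
    obtain ⟨b, hb, hble⟩ := isMeasure_formulaLE.rename (fun i => 3 * i + 1) ih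
    obtain ⟨c, hc, hcle⟩ := isMeasure_formulaLE.rename (fun i => 3 * i + 2) ih
    refine ⟨.add (.mul a b) c, by simp only [Formula.eval, ha, hb, hc]; rfl, ?_⟩
    have : 0 < 3 ^ d := by positivity
    simp only [Formula.size, pow_succ]
    omega

/-- Projections of `T d` combine to projections of `T (d + 1)`. -/
theorem isProjection_mul_add {a b c : MvPolynomial ℕ K} {d : ℕ}
    (ha : IsProjection a (formulaUniversal K d)) (hb : IsProjection b (formulaUniversal K d))
    (hc : IsProjection c (formulaUniversal K d)) :
    IsProjection (a * b + c) (formulaUniversal K (d + 1)) := by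
  rw [isProjection_iff] at *
  obtain ⟨α, hα, rfl⟩ := ha
  obtain ⟨β, hβ, rfl⟩ := hb
  obtain ⟨γ, hγ, rfl⟩ := hc
  refine ⟨fun i => if i % 3 = 0 then α (i / 3) else if i % 3 = 1 then β (i / 3) else γ (i / 3),
    fun i => ?_, ?_⟩
  · beta_reduce
    split_ifs
    exacts [hα _, hβ _, hγ _]
  · rw [formulaUniversal, map_add, map_mul, aeval_rename, aeval_rename, aeval_rename]
    congr 4
    · funext i
      simp
    · funext i
      simp [Nat.add_mod, show (3 * i + 1) / 3 = i by omega]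
    · funext i
      simp [Nat.add_mod, show (3 * i + 2) / 3 = i by omega]

theorem IsSimple.isProjection_formulaUniversal {p : MvPolynomial ℕ K} (hp : IsSimple p) (d : ℕ) :
    IsProjection p (formulaUniversal K d) := by
  induction d generalizing p with
  | zero => exact ⟨fun _ => p, fun _ => hp, by simp [formulaUniversal]⟩
  | succ d ih => simpa using isProjection_mul_add (ih isSimple_zero) (ih isSimple_zero) (ih hp)

/-- This is Brent's balancing: a separator at half of the gates leaves two arguments and two
contexts of at most half the size. Two levels of the pattern `a * b + c` reassemble them: the lower
one forms `A₁ - A₀` and `q`, the upper one `(A₁ - A₀) * q + A₀`. -/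
theorem Formula.isProjection_formulaUniversal (k : ℕ) (φ : Formula K) (h : φ.gates < 2 ^ k) :
    IsProjection φ.eval (formulaUniversal K (2 * k)) := by
  induction k generalizing φ with
  | zero =>
    cases φ with
    | var i => exact (isSimple_X i).isProjection_formulaUniversal 0
    | const c => exact (isSimple_C c).isProjection_formulaUniversal 0
    | add a b => simp [gates] at h
    | mul a b => simp [gates] at h
  | succ k ih =>
    have simple (p : MvPolynomial ℕ K) (hp : IsSimple p) (d : ℕ) :=
      hp.isProjection_formulaUniversal d
    have up : ∀ {p : MvPolynomial ℕ K} {d : ℕ}, IsProjection p (formulaUniversal K d) →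
        IsProjection p (formulaUniversal K (d + 1)) := fun {p d} hp => by
      simpa using isProjection_mul_add (simple 0 isSimple_zero d) (simple 0 isSimple_zero d) hp
    have hk : 2 ^ (k + 1) = 2 * 2 ^ k := by ring
    rw [show 2 * (k + 1) = 2 * k + 1 + 1 by ring]
    -- A formula without gates has no separator and is lifted by two levels instead.
    by_cases h0 : φ.gates = 0
    · exact up (up (ih φ (by rw [h0]; positivity)))
    obtain ⟨ψ₁, ψ₂, A₀, A₁, q, hq, hψ₁, hψ₂, h₀, h₁, he⟩ :=
      exists_separator (φ.gates / 2) φ (by omega)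
    have p₁ := ih ψ₁ (by omega)
    have p₂ := ih ψ₂ (by omega)
    have q₀ := ih A₀ (by omega)
    have q₁ := ih A₁ (by omega)
    rw [he]
    refine isProjection_mul_add ?_ ?_ (up q₀)
    · have := isProjection_mul_add q₀ (simple _ (isSimple_C (-1)) _) q₁
      convert this using 1
      rw [C_neg, C_1]
      ring
    · rcases hq with rfl | rfl
      · have := isProjection_mul_add p₁ (simple _ isSimple_one _) p₂
        rwa [mul_one] at this
      · have := isProjection_mul_add p₁ p₂ (simple _ isSimple_zero _)
        rwa [add_zero] at this

end

/-- The universal family for formulas. -/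
noncomputable def formulaFamily (R : Type u) [CommRing R] : Family R := fun n =>
  formulaUniversal R (2 * (Nat.log 2 n + 1))

theorem formulaFamily_mem_VF (K : Type u) [Field K] : formulaFamily K ∈ VF K := by
  have hs : PolyBounded (fun n => 2 * 3 ^ (2 * (Nat.log 2 n + 1)) - 1) := by
    refine ((PolyBounded.const 2).mul ((PolyBounded.const 16).mul
      ((PolyBounded.id.add (.const 1)).pow 4))).mono fun n => ?_
    have h1 : 2 ^ Nat.log 2 n ≤ n + 1 := by
      rcases Nat.eq_zero_or_pos n with rfl | hn
      · simp
      · exact (Nat.pow_log_le_self 2 hn.ne').trans (Nat.le_succ n)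
    -- Enlarging the base `9` to `16 = 2 ^ 4` turns the power into a fourth power of `2 ^ Nat.log 2
    -- n`.
    calc 2 * 3 ^ (2 * (Nat.log 2 n + 1)) - 1 ≤ 2 * 3 ^ (2 * (Nat.log 2 n + 1)) := Nat.sub_le _ _
      _ = 2 * 9 ^ (Nat.log 2 n + 1) := by rw [pow_mul]; norm_num
      _ ≤ 2 * 16 ^ (Nat.log 2 n + 1) := by gcongr; norm_num
      _ = 2 * (16 * (2 ^ Nat.log 2 n) ^ 4) := by
        rw [← pow_mul, mul_comm _ 4, pow_mul, pow_succ]; ring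
      _ ≤ 2 * (16 * (n + 1) ^ 4) := by gcongr
  refine ⟨⟨hs.mono fun n => ?_, hs.mono fun n => ?_⟩, _, hs,
    fun n => formulaUniversal_formulaLE _⟩
  · obtain ⟨φ, h, hle⟩ := formulaUniversal_formulaLE (K := K) (2 * (Nat.log 2 n + 1))
    rw [formulaFamily, ← h]
    exact φ.vars_card_eval_le.trans hle
  · obtain ⟨φ, h, hle⟩ := formulaUniversal_formulaLE (K := K) (2 * (Nat.log 2 n + 1))
    rw [formulaFamily, ← h]
    exact φ.totalDegree_eval_le.trans hle

theorem VF_pProjection_formulaFamily {K : Type u} [Field K] {g : Family K} (hg : g ∈ VF K) :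
    PProjection g (formulaFamily K) := by
  obtain ⟨-, s, hs, h⟩ := hg
  refine ⟨s, hs, fun n => ?_⟩
  obtain ⟨φ, he, hle⟩ := h n
  rw [← he]
  exact φ.isProjection_formulaUniversal _
    ((φ.gates_lt_size.trans_le hle).trans (Nat.lt_pow_succ_log_self one_lt_two _))

theorem isDenseIn_VF (K : Type u) [Field K] (r : ReductionKind) :
    IsDenseIn (Complete VF r) VF K := by
  rw [VF_eq]
  exact isDenseIn_complete isMeasure_formulaLE _ (formulaFamily _)
    (fun n => map_formulaUniversal _ _) (formulaFamily_mem_VF _)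
    (fun g hg => VF_pProjection_formulaFamily hg) r

/-! ### Straight-line programs -/

section StraightLine

variable {K : Type u} [Field K]

/-- `p` arises by one (skew, if `sk`) operation from polynomials in `S`. -/
def Step (sk : Prop) (S : Set (MvPolynomial ℕ K)) (p : MvPolynomial ℕ K) : Prop :=
  IsSimple p ∨ (∃ a ∈ S, ∃ b ∈ S, p = a + b) ∨
    ∃ a ∈ S, ∃ b ∈ S, (sk → IsSimple a) ∧ p = a * b

/-- Some (skew, if `sk`) straight-line program with `n` instructions computes all polynomials
in `S`. -/
def Comp (sk : Prop) (n : ℕ) (S : Set (MvPolynomial ℕ K)) : Prop :=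
  ∃ v : ℕ → MvPolynomial ℕ K, (∀ k < n, Step sk (v '' Set.Iio k) (v k)) ∧ S ⊆ v '' Set.Iio n

variable {sk : Prop} {S T : Set (MvPolynomial ℕ K)} {p q : MvPolynomial ℕ K} {n m : ℕ}

theorem Step.mono (h : Step sk S p) (hST : S ⊆ T) : Step sk T p := by
  rcases h with h | ⟨a, ha, b, hb, h⟩ | ⟨a, ha, b, hb, h⟩
  exacts [Or.inl h, Or.inr (Or.inl ⟨a, hST ha, b, hST hb, h⟩),
    Or.inr (Or.inr ⟨a, hST ha, b, hST hb, h⟩)]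

theorem Step.image {L : Type u} [Field L] (h : Step sk S p)
    (φ : MvPolynomial ℕ K →+* MvPolynomial ℕ L) (hφ : ∀ p, IsSimple p → IsSimple (φ p)) :
    Step sk (φ '' S) (φ p) := by
  rcases h with h | ⟨a, ha, b, hb, rfl⟩ | ⟨a, ha, b, hb, hs, rfl⟩
  exacts [Or.inl (hφ _ h),
    Or.inr (Or.inl ⟨_, ⟨a, ha, rfl⟩, _, ⟨b, hb, rfl⟩, map_add _ _ _⟩),
    Or.inr (Or.inr ⟨_, ⟨a, ha, rfl⟩, _, ⟨b, hb, rfl⟩, fun h => hφ _ (hs h), map_mul _ _ _⟩)]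

theorem Step.add (hp : p ∈ S) (hq : q ∈ S) : Step sk S (p + q) :=
  Or.inr (Or.inl ⟨p, hp, q, hq, rfl⟩)

theorem Step.mul (hp : p ∈ S) (hq : q ∈ S) (h : sk → IsSimple p) : Step sk S (p * q) :=
  Or.inr (Or.inr ⟨p, hp, q, hq, h, rfl⟩)

/-! ### Building and bounding straight-line programs -/

namespace Comp

theorem subset (h : Comp sk n T) (hST : S ⊆ T) : Comp sk n S := by
  obtain ⟨v, hv, hT⟩ := h
  exact ⟨v, hv, hST.trans hT⟩

theorem empty : Comp sk 0 (∅ : Set (MvPolynomial ℕ K)) :=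
  ⟨fun _ => 0, by simp, by simp⟩

theorem insert (h : Comp sk n S) (hp : Step sk S p) : Comp sk (n + 1) (insert p S) := by
  obtain ⟨v, hv, hS⟩ := h
  have himg : ∀ k ≤ n, Function.update v n p '' Set.Iio k = v '' Set.Iio k := fun k hk =>
    Set.image_congr fun i hi =>
      Function.update_of_ne (ne_of_lt ((Set.mem_Iio.1 hi).trans_le hk)) _ _
  refine ⟨Function.update v n p, fun k hk => ?_, ?_⟩
  · rw [himg k (by omega)]
    rcases (Nat.lt_succ_iff.1 hk).eq_or_lt with rfl | hk
    · rw [Function.update_self]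
      exact hp.mono hS
    · rw [Function.update_of_ne hk.ne]
      exact hv k hk
  · intro q hq
    rcases hq with rfl | hq
    · exact ⟨n, by simp, by simp⟩
    · have := hS hq
      rw [← himg n le_rfl] at this
      exact Set.image_mono (Set.Iio_subset_Iio (Nat.le_succ n)) this

theorem mono (h : Comp sk n S) (hnm : n ≤ m) : Comp sk m S := by
  induction hnm with
  | refl => exact h
  | step _ ih => exact (ih.insert (Or.inl isSimple_zero)).subset (Set.subset_insert _ _)

theorem insert_image {ι : Type*} (h : Comp sk n S) (I : Finset ι) (f : ι → MvPolynomial ℕ K)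
    (hf : ∀ i ∈ I, Step sk S (f i)) : Comp sk (n + I.card) (S ∪ f '' I) := by
  classical
  induction I using Finset.induction_on with
  | empty => simpa using h
  | insert a I ha ih =>
    rw [Finset.card_insert_of_notMem ha, ← add_assoc]
    refine ((ih fun i hi => hf i (by simp [hi])).insert (p := f a)
      ((hf a (by simp)).mono Set.subset_union_left)).subset ?_
    rw [Finset.coe_insert, Set.image_insert_eq, Set.union_insert]

theorem insert_sum {ι : Type*} (h : Comp sk n S) (I : Finset ι) (f : ι → MvPolynomial ℕ K)
    (hf : ∀ i ∈ I, f i ∈ S) :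
    Comp sk (n + (I.card + 1)) (Insert.insert (∑ i ∈ I, f i) S) := by
  classical
  induction I using Finset.induction_on with
  | empty => simpa using h.insert (Or.inl isSimple_zero)
  | insert a I ha ih =>
    rw [Finset.sum_insert ha, Finset.card_insert_of_notMem ha]
    refine ((ih fun i hi => hf i (by simp [hi])).insert
      (Step.add (Or.inr (hf a (by simp))) (Or.inl rfl))).subset ?_
    exact Set.insert_subset_insert (Set.subset_insert _ _)

/-- The blocks of at most `N` instructions are appended in turn; each must therefore work over any
extension `S'` of `S` produced by the earlier ones. -/
theorem union_image {ι : Type*} (h : Comp sk n S) (I : Finset ι) (f : ι → MvPolynomial ℕ K)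
    (N : ℕ) (hf : ∀ i ∈ I, ∀ (n' : ℕ) (S' : Set (MvPolynomial ℕ K)), S ⊆ S' → Comp sk n' S' →
      Comp sk (n' + N) (Insert.insert (f i) S')) :
    Comp sk (n + I.card * N) (S ∪ f '' I) := by
  classical
  induction I using Finset.induction_on with
  | empty => simpa using h
  | insert a I ha ih =>
    rw [Finset.card_insert_of_notMem ha, add_mul, one_mul, ← add_assoc]
    refine (hf a (by simp) _ _ Set.subset_union_left
      (ih fun i hi => hf i (by simp [hi]))).subset ?_
    rw [Finset.coe_insert, Set.image_insert_eq, Set.union_insert]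

theorem image {L : Type u} [Field L] (h : Comp sk n S)
    (φ : MvPolynomial ℕ K →+* MvPolynomial ℕ L) (hφ : ∀ p, IsSimple p → IsSimple (φ p)) :
    Comp sk n (φ '' S) := by
  obtain ⟨v, hv, hS⟩ := h
  refine ⟨fun i => φ (v i), fun k hk => ?_, ?_⟩
  · have := (hv k hk).image φ hφ
    rwa [Set.image_image] at this
  · rintro _ ⟨p, hp, rfl⟩
    obtain ⟨i, hi, rfl⟩ := hS hp
    exact ⟨i, hi, rfl⟩

theorem union (hS : Comp sk n S) (hT : Comp sk m T) : Comp sk (n + m) (S ∪ T) := by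
  obtain ⟨w, hw, hT⟩ := hT
  have key : ∀ k ≤ m, Comp sk (n + k) (S ∪ w '' Set.Iio k) := by
    intro k hk
    induction k with
    | zero => simpa using hS
    | succ k ih =>
      refine ((ih (by omega)).insert (p := w k)
        ((hw k (by omega)).mono Set.subset_union_right)).subset ?_
      rw [← Set.union_insert, ← Set.image_insert_eq]
      refine Set.union_subset_union_right _ (Set.image_mono fun i hi => ?_)
      simp only [Set.mem_Iio, Set.mem_insert_iff] at *
      omega
  exact (key m le_rfl).subset (Set.union_subset_union_right _ hT)

/-- Variables enter only through instructions with a simple value, and each of these has at most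
one. -/
theorem vars_card_le (h : Comp sk n S) (hp : p ∈ S) : p.vars.card ≤ n := by
  classical
  obtain ⟨v, hv, hS⟩ := h
  have key : ∀ k < n, (v k).vars ⊆ (Finset.range n).biUnion
      fun i => if IsSimple (v i) then (v i).vars else ∅ := by
    intro k
    induction k using Nat.strong_induction_on with
    | _ k ih =>
      intro hk
      rcases hv k hk with h | ⟨_, ⟨i, hi, rfl⟩, _, ⟨j, hj, rfl⟩, h⟩ |
        ⟨_, ⟨i, hi, rfl⟩, _, ⟨j, hj, rfl⟩, -, h⟩
      · intro x hx
        exact Finset.mem_biUnion.2 ⟨k, by simpa using hk, by simpa [h] using hx⟩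
      · rw [h]
        exact (vars_add_subset _ _).trans
          (Finset.union_subset (ih i hi (hi.trans hk)) (ih j hj (hj.trans hk)))
      · rw [h]
        exact (vars_mul _ _).trans
          (Finset.union_subset (ih i hi (hi.trans hk)) (ih j hj (hj.trans hk)))
  obtain ⟨k, hk, rfl⟩ := hS hp
  refine (Finset.card_le_card (key k hk)).trans (Finset.card_biUnion_le.trans ?_)
  refine (Finset.sum_le_card_nsmul _ _ 1 fun i _ => ?_).trans (by simp)
  split_ifs with h
  · exact h.vars_card_le
  · simp

/-- A skew instruction raises the largest degree so far by at most one. A general product may double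
it, so the universal family for circuits needs a separate degree bound. -/
theorem totalDegree_le (h : Comp True n S) (hp : p ∈ S) : p.totalDegree ≤ n := by
  obtain ⟨v, hv, hS⟩ := h
  have key : ∀ k < n, (v k).totalDegree ≤ k + 1 := by
    intro k
    induction k using Nat.strong_induction_on with
    | _ k ih =>
      intro hk
      rcases hv k hk with h | ⟨_, ⟨i, hi, rfl⟩, _, ⟨j, hj, rfl⟩, h⟩ |
        ⟨_, ⟨i, hi, rfl⟩, _, ⟨j, hj, rfl⟩, hs, h⟩
      · exact h.totalDegree_le.trans (by omega)
      · have h₁ := ih i hi (hi.trans hk)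
        have h₂ := ih j hj (hj.trans hk)
        rw [Set.mem_Iio] at hi hj
        rw [h]
        exact (totalDegree_add _ _).trans (by omega)
      · have h₁ := (hs trivial).totalDegree_le
        have h₂ := ih j hj (hj.trans hk)
        rw [Set.mem_Iio] at hi hj
        rw [h]
        exact (totalDegree_mul _ _).trans (by omega)
  obtain ⟨k, hk, rfl⟩ := hS hp
  exact (key k hk).trans hk

end Comp

/-! ### Straight-line programs and circuits -/

theorem Gate.IsLeaf.isSimple_value {S : Set (MvPolynomial ℕ K)} {V : Type} {γ : Gate S V}
    (h : γ.IsLeaf) (val : V → MvPolynomial ℕ K) : IsSimple (γ.value val) := by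
  cases γ with
  | var i => exact isSimple_X i
  | const c => exact isSimple_C c
  | _ => exact h.elim

/-- The nodes are listed in topological order, by growing a set of nodes that is closed under taking
inputs. -/
theorem Circuit.comp (c : Circuit (∅ : Set (MvPolynomial ℕ K))) (hc : c.Computes p)
    (hsk : sk → c.IsSkew) : Comp sk c.size {p} := by
  classical
  obtain ⟨val, hval, rfl⟩ := hc
  let _ := c.fintypeNode
  have key : ∀ k ≤ Fintype.card c.Node, ∃ D : Finset c.Node, D.card = k ∧
      Comp sk k (val '' D) := by
    intro k hk
    suffices ∃ D : Finset c.Node, D.card = k ∧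
        (∀ v ∈ D, ∀ u, (c.gate v).HasInput u → u ∈ D) ∧ Comp sk k (val '' D) by
      obtain ⟨D, h₁, -, h₂⟩ := this
      exact ⟨D, h₁, h₂⟩
    induction k with
    | zero => exact ⟨∅, rfl, by simp, by simpa using Comp.empty⟩
    | succ k ih =>
      obtain ⟨D, hD, hdown, hcomp⟩ := ih (by omega)
      -- A minimal node outside `D` has all its inputs in `D`, so it can be the next instruction.
      obtain ⟨m, hm, hmin⟩ := c.acyclic.has_min {v | v ∉ D} (by
        by_contra hne
        rw [Set.not_nonempty_iff_eq_empty] at hne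
        have : D = Finset.univ := by
          ext v
          simpa using fun h : v ∉ D => (hne ▸ h : v ∈ (∅ : Set c.Node))
        rw [this, Finset.card_univ] at hD
        omega)
      have hin : ∀ u, (c.gate m).HasInput u → u ∈ D := fun u hu => by
        by_contra hcon
        exact hmin u hcon hu
      refine ⟨insert m D, by rw [Finset.card_insert_of_notMem hm, hD], ?_, ?_⟩
      · intro v hv u hu
        rcases Finset.mem_insert.1 hv with rfl | hv
        · exact Finset.mem_insert_of_mem (hin u hu)
        · exact Finset.mem_insert_of_mem (hdown v hv u hu)
      · rw [Finset.coe_insert, Set.image_insert_eq]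
        refine hcomp.insert ?_
        have hmem : ∀ u, (c.gate m).HasInput u → val u ∈ val '' (D : Set c.Node) :=
          fun u hu => ⟨u, hin u hu, rfl⟩
        rw [hval m]
        cases hg : c.gate m with
        | var i => exact Or.inl (isSimple_X i)
        | const a => exact Or.inl (isSimple_C a)
        | add a b =>
          rw [hg] at hmem
          exact Step.add (hmem a (Or.inl rfl)) (hmem b (Or.inr rfl))
        | mul a b =>
          rw [hg] at hmem
          -- `Step` expects the simple factor first, so the factors are swapped unless the first
          -- input is a leaf.
          by_cases ha : (c.gate a).IsLeaf
          · refine Step.mul (hmem a (Or.inl rfl)) (hmem b (Or.inr rfl)) fun _ => ?_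
            rw [hval a]
            exact ha.isSimple_value val
          · rw [Gate.value, mul_comm]
            refine Step.mul (hmem b (Or.inr rfl)) (hmem a (Or.inl rfl)) fun h => ?_
            rw [hval b]
            exact ((hsk h m a b hg).resolve_left ha).isSimple_value val
        | oracle g h args => exact absurd h (by simp)
  obtain ⟨D, hD, h⟩ := key _ le_rfl
  rw [Finset.card_eq_iff_eq_univ] at hD
  refine h.subset ?_
  simp [hD]

theorem Comp.exists_circuit (h : Comp sk n {p}) :
    ∃ c : Circuit (∅ : Set (MvPolynomial ℕ K)), (sk → c.IsSkew) ∧ c.Computes p ∧ c.size ≤ n := by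
  classical
  obtain ⟨v, hv, hS⟩ := h
  obtain ⟨r, hr, hvr⟩ := hS rfl
  have hgate : ∀ k : Fin n, ∃ γ : Gate (∅ : Set (MvPolynomial ℕ K)) (Fin n),
      (∀ u, γ.HasInput u → u < k) ∧ v k = γ.value (fun i : Fin n => v i) ∧
      (IsSimple (v k) → γ.IsLeaf) ∧ (∀ a b, γ = .mul a b → sk → IsSimple (v a)) := by
    intro k
    -- Skew programs require a factor with a simple value, skew circuits a factor that is a leaf.
    -- Hence every simple value becomes a leaf, however it was computed.
    by_cases hsimple : IsSimple (v k)
    · rcases hsimple with ⟨j, hj⟩ | ⟨c, hc⟩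
      · exact ⟨.var j, by simp [Gate.HasInput], hj, fun _ => trivial, by simp⟩
      · exact ⟨.const c, by simp [Gate.HasInput], hc, fun _ => trivial, by simp⟩
    · rcases hv k k.2 with h | ⟨_, ⟨i, hi, rfl⟩, _, ⟨j, hj, rfl⟩, h⟩ |
        ⟨_, ⟨i, hi, rfl⟩, _, ⟨j, hj, rfl⟩, hs, h⟩
      · exact absurd h hsimple
      · refine ⟨.add ⟨i, lt_trans hi k.2⟩ ⟨j, lt_trans hj k.2⟩, ?_, h,
          fun h => absurd h hsimple, by simp⟩
        rintro u (rfl | rfl)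
        exacts [hi, hj]
      · refine ⟨.mul ⟨i, lt_trans hi k.2⟩ ⟨j, lt_trans hj k.2⟩, ?_, h,
          fun h => absurd h hsimple, ?_⟩
        · rintro u (rfl | rfl)
          exacts [hi, hj]
        · intro a b hab hsk
          obtain ⟨rfl, rfl⟩ := Gate.mul.inj hab
          exact hs hsk
  choose γ hlt hval hleaf hmul using hgate
  refine ⟨{ Node := Fin n, fintypeNode := inferInstance, gate := γ,
            acyclic := Subrelation.wf (fun {a b} h => hlt b a h) (wellFounded_lt (α := Fin n)),
            root := ⟨r, hr⟩ }, fun hsk k a b hk => ?_, ⟨fun i => v i, hval, hvr⟩, ?_⟩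
  · exact Or.inl (hleaf a (hmul k a b hk hsk))
  · simp [Circuit.size]

end StraightLine

/-- Some (skew, if `sk`) straight-line program with `n` instructions computes `p`. -/
def CompLE (sk : Prop) (K : Type u) [Field K] (p : MvPolynomial ℕ K) (n : ℕ) : Prop :=
  Comp sk n {p}

theorem VP_eq : (VP.{u} : ComplexityClass.{u}) = classOf (CompLE False) := by
  funext K _
  ext f
  refine and_congr_right fun _ => exists_congr fun s => and_congr_right fun _ =>
    forall_congr' fun n => ⟨?_, fun h => ?_⟩
  · rintro ⟨c, hc, hle⟩
    exact (c.comp hc False.elim).mono hle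
  · obtain ⟨c, -, hc, hle⟩ := Comp.exists_circuit h
    exact ⟨c, hc, hle⟩

theorem VBP_eq : (VBP.{u} : ComplexityClass.{u}) = classOf (CompLE True) := by
  funext K _
  ext f
  refine and_congr_right fun _ => exists_congr fun s => and_congr_right fun _ =>
    forall_congr' fun n => ⟨?_, fun h => ?_⟩
  · rintro ⟨c, hsk, hc, hle⟩
    exact (c.comp hc fun _ => hsk).mono hle
  · obtain ⟨c, hsk, hc, hle⟩ := Comp.exists_circuit h
    exact ⟨c, hsk trivial, hc, hle⟩

theorem isMeasure_compLE (sk : Prop) : IsMeasure (CompLE.{u} sk) where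
  mono := fun h hab => Comp.mono h hab
  simple := fun hp => (Comp.empty.insert (Or.inl hp)).subset (by simp)
  add := fun hp hq => ((Comp.union hp hq).insert
    (Step.add (Or.inl rfl) (Or.inr rfl))).subset (by simp)
  mul := fun hq hp => ((Comp.insert hp (Or.inl hq)).insert
    (Step.mul (Or.inl rfl) (Or.inr rfl) fun _ => hq)).subset (by simp)
  rename := fun φ h => by
    have := Comp.image h (MvPolynomial.rename φ).toRingHom fun p hp => hp.rename φ
    simpa [CompLE] using this
  map := fun φ h => by
    have := Comp.image h (MvPolynomial.map φ) fun p hp => hp.map φ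
    simpa [CompLE] using this

/-! ### A universal family for skew circuits -/

/-- The universal polynomials for skew straight-line programs. -/
noncomputable def skewUniversal (R : Type u) [CommRing R] (k : ℕ) : MvPolynomial ℕ R :=
  X (Nat.pair k k) + ∑ j : Fin k, X (Nat.pair k j) * skewUniversal R j
termination_by k
decreasing_by exact j.2

theorem skewUniversal_eq (R : Type u) [CommRing R] (k : ℕ) :
    skewUniversal R k = X (Nat.pair k k) +
      ∑ j ∈ Finset.range k, X (Nat.pair k j) * skewUniversal R j := by
  rw [skewUniversal, Finset.sum_range]

theorem map_skewUniversal {R S : Type u} [CommRing R] [CommRing S] (φ : R →+* S) (k : ℕ) :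
    map φ (skewUniversal R k) = skewUniversal S k := by
  induction k using Nat.strong_induction_on with
  | _ k ih =>
    rw [skewUniversal_eq, skewUniversal_eq, map_add, map_sum, map_X]
    refine congrArg₂ _ rfl (Finset.sum_congr rfl fun j hj => ?_)
    rw [map_mul, map_X, ih j (Finset.mem_range.1 hj)]

section

variable {K : Type u} [Field K]

/-- Stage `k` consists of `k + 1` variables, `k` products, `k + 1` instructions for their sum and
one last addition, that is, `3 * k + 3` instructions. -/
theorem skewUniversal_comp (N k : ℕ) (hk : k ≤ N) :
    Comp True (k * (3 * N + 3)) (skewUniversal K '' Set.Iio k) := by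
  induction k with
  | zero => simpa using Comp.empty
  | succ k ih =>
    have h₀ := ih (by omega)
    have h₁ := h₀.insert_image (Finset.range (k + 1)) (fun j => X (Nat.pair k j))
      fun j _ => Or.inl (isSimple_X _)
    have h₂ := h₁.insert_image (Finset.range k)
      (fun j => X (Nat.pair k j) * skewUniversal K j) fun j hj =>
        Step.mul (Or.inr ⟨j, by simp at hj ⊢; omega, rfl⟩) (Or.inl ⟨j, by simpa using hj, rfl⟩)
          fun _ => isSimple_X _
    have h₃ := h₂.insert_sum (Finset.range k)
      (fun j => X (Nat.pair k j) * skewUniversal K j) fun j hj => Or.inr ⟨j, hj, rfl⟩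
    have h₄ := h₃.insert (p := skewUniversal K k) (by
      rw [skewUniversal_eq]
      exact Step.add (Or.inr (Or.inl (Or.inr ⟨k, by simp, rfl⟩))) (Or.inl rfl))
    refine (h₄.mono ?_).subset ?_
    · simp only [Finset.card_range, add_mul]
      omega
    · rintro _ ⟨j, hj, rfl⟩
      rcases (Nat.lt_succ_iff.1 hj).eq_or_lt with rfl | hj
      · exact Or.inl rfl
      · exact Or.inr (Or.inr (Or.inl (Or.inl ⟨j, hj, rfl⟩)))

/-- The recursion of `v` is the recursion of `skewUniversal` with specialized coefficients: row `k`
of the variables receives the values `y` of step `k`. -/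
theorem isProjection_skewUniversal (n : ℕ) (v : ℕ → MvPolynomial ℕ K)
    (h : ∀ k ≤ n, ∃ y : ℕ → MvPolynomial ℕ K, (∀ j, IsSimple (y j)) ∧
      v k = y k + ∑ j ∈ Finset.range k, y j * v j) :
    IsProjection (v n) (skewUniversal K n) := by
  have h' : ∀ k, ∃ y : ℕ → MvPolynomial ℕ K, (∀ j, IsSimple (y j)) ∧
      (k ≤ n → v k = y k + ∑ j ∈ Finset.range k, y j * v j) := fun k => by
    by_cases hk : k ≤ n
    · obtain ⟨y, hy, he⟩ := h k hk
      exact ⟨y, hy, fun _ => he⟩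
    · exact ⟨fun _ => 0, fun _ => isSimple_zero, fun h => absurd h hk⟩
  choose y hy he using h'
  refine isProjection_iff.2 ⟨fun i => y i.unpair.1 i.unpair.2, fun i => hy _ _, ?_⟩
  suffices ∀ k ≤ n, v k = aeval (fun i : ℕ => y i.unpair.1 i.unpair.2) (skewUniversal K k) from
    this n le_rfl
  intro k
  induction k using Nat.strong_induction_on with
  | _ k ih =>
    intro hk
    rw [he k hk, skewUniversal_eq, map_add, map_sum, aeval_X, Nat.unpair_pair]
    refine congrArg₂ _ rfl (Finset.sum_congr rfl fun j hj => ?_)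
    have hj := Finset.mem_range.1 hj
    rw [map_mul, aeval_X, Nat.unpair_pair, ih j hj (by omega)]

theorem sum_ite_eq_mul (k i : ℕ) (hi : i < k) (a : MvPolynomial ℕ K)
    (v : ℕ → MvPolynomial ℕ K) :
    ∑ j ∈ Finset.range k, (if j = i then a else 0) * v j = a * v i := by
  simp [ite_mul, hi]

theorem CompLE.isProjection_skewUniversal {p : MvPolynomial ℕ K} {n : ℕ}
    (h : CompLE True K p n) : IsProjection p (skewUniversal K n) := by
  obtain ⟨v, hv, hS⟩ := h
  obtain ⟨r, hr, rfl⟩ := hS rfl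
  -- The result, at some index `r < n`, is copied to index `n`, where the universal polynomial is
  -- read off.
  have hlt : ∀ k < n, Function.update v n (v r) k = v k := fun k hk =>
    Function.update_of_ne hk.ne _ _
  have := AlgComplexity.isProjection_skewUniversal n (Function.update v n (v r)) fun k hk => ?_
  · rwa [Function.update_self] at this
  have hsum : ∀ y : ℕ → MvPolynomial ℕ K,
      ∑ j ∈ Finset.range k, y j * Function.update v n (v r) j =
        ∑ j ∈ Finset.range k, y j * v j := fun y =>
    Finset.sum_congr rfl fun j hj => by rw [hlt j (by simp at hj; omega)]
  simp only [hsum]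
  rcases hk.eq_or_lt with rfl | hk
  · refine ⟨fun j => if j = r then 1 else 0, fun j => ?_, ?_⟩
    · beta_reduce
      split_ifs
      exacts [isSimple_one, isSimple_zero]
    · rw [Set.mem_Iio] at hr
      rw [sum_ite_eq_mul k r hr, Function.update_self]
      simp [hr.ne']
  rw [hlt k hk]
  rcases hv k hk with h | ⟨_, ⟨i, hi, rfl⟩, _, ⟨j, hj, rfl⟩, h⟩ |
    ⟨_, ⟨i, hi, rfl⟩, _, ⟨j, hj, rfl⟩, hs, h⟩
  · refine ⟨fun j => if j = k then v k else 0, fun j => ?_, ?_⟩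
    · beta_reduce
      split_ifs
      exacts [h, isSimple_zero]
    · beta_reduce
      rw [if_pos rfl, Finset.sum_eq_zero, add_zero]
      intro j hj
      rw [if_neg (ne_of_lt (Finset.mem_range.1 hj)), zero_mul]
  -- The two summands may be the same instruction; the coefficient is then the constant `1 + 1`,
  -- which is still simple.
  · refine ⟨fun l => C ((if l = i then 1 else 0) + (if l = j then 1 else 0)),
      fun _ => isSimple_C _, ?_⟩
    rw [Set.mem_Iio] at hi hj
    have e : ∀ l m : ℕ, (C (if l = m then (1 : K) else 0) : MvPolynomial ℕ K) =
        if l = m then 1 else 0 := fun l m => by split_ifs <;> simp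
    simp only [C_add, e, add_mul, Finset.sum_add_distrib, sum_ite_eq_mul k i hi,
      sum_ite_eq_mul k j hj, hi.ne', hj.ne', if_false, h, C_0]
    ring
  · refine ⟨fun l => if l = j then v i else 0, fun l => ?_, ?_⟩
    · beta_reduce
      split_ifs
      exacts [hs trivial, isSimple_zero]
    · rw [Set.mem_Iio] at hj
      rw [sum_ite_eq_mul k j hj, h]
      simp [hj.ne']

theorem skewUniversal_compLE (n : ℕ) :
    CompLE True K (skewUniversal K n) ((n + 1) * (3 * (n + 1) + 3)) :=
  (skewUniversal_comp (n + 1) (n + 1) le_rfl).subset (by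
    rintro _ rfl
    exact ⟨n, by simp, rfl⟩)

theorem skewUniversal_mem : (fun n => skewUniversal K n) ∈ classOf (CompLE True) K := by
  have hs : PolyBounded (fun n => (n + 1) * (3 * (n + 1) + 3)) :=
    (PolyBounded.id.add (.const 1)).mul
      (((PolyBounded.const 3).mul (PolyBounded.id.add (.const 1))).add (.const 3))
  exact ⟨⟨hs.mono fun n => Comp.vars_card_le (skewUniversal_compLE n) rfl,
    hs.mono fun n => Comp.totalDegree_le (skewUniversal_compLE n) rfl⟩, _, hs,
    skewUniversal_compLE⟩

theorem isDenseIn_VBP (K : Type u) [Field K] (r : ReductionKind) :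
    IsDenseIn (Complete VBP r) VBP K := by
  rw [VBP_eq]
  exact isDenseIn_complete (isMeasure_compLE True) _ (fun n => skewUniversal _ n)
    (fun n => map_skewUniversal _ _) skewUniversal_mem
    (fun g ⟨_, s, hs, h⟩ => ⟨s, hs, fun n => (h n).isProjection_skewUniversal⟩) r

end

/-! ### A universal family for circuits -/

/-- In the coefficient of `m`, a splitting `m = a + b` contributes only to the pair of the degrees
of `a` and `b`, which lies on the antidiagonal of `d` exactly if `m` has degree `d`. -/
theorem homogeneousComponent_mul {R : Type u} [CommRing R] (p q : MvPolynomial ℕ R) (d : ℕ) :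
    homogeneousComponent d (p * q) = ∑ x ∈ Finset.HasAntidiagonal.antidiagonal d,
      homogeneousComponent x.1 p * homogeneousComponent x.2 q := by
  classical
  ext m
  rw [coeff_homogeneousComponent, coeff_mul, coeff_sum]
  simp only [coeff_mul, coeff_homogeneousComponent]
  rw [Finset.sum_comm]
  have key : ∀ x ∈ Finset.HasAntidiagonal.antidiagonal m, ∑ y ∈ Finset.HasAntidiagonal.antidiagonal d,
      (if x.1.degree = y.1 then coeff x.1 p else 0) *
        (if x.2.degree = y.2 then coeff x.2 q else 0) =
      if m.degree = d then coeff x.1 p * coeff x.2 q else 0 := by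
    rintro ⟨a, b⟩ hx
    have hm : m.degree = a.degree + b.degree := by
      rw [← Finset.HasAntidiagonal.mem_antidiagonal.1 hx, map_add]
    split_ifs with hd
    · rw [Finset.sum_eq_single (a.degree, b.degree)]
      · simp
      · rintro ⟨i, j⟩ _ hne
        by_cases hi : a.degree = i
        · rw [if_neg (c := b.degree = j), mul_zero]
          rintro rfl
          exact hne (by rw [hi])
        · rw [if_neg hi, zero_mul]
      · intro h
        exact absurd (Finset.HasAntidiagonal.mem_antidiagonal.2 (hm.symm.trans hd)) h
    · refine Finset.sum_eq_zero fun y hy => ?_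
      have hy := Finset.HasAntidiagonal.mem_antidiagonal.1 hy
      by_cases hi : a.degree = y.1
      · rw [if_neg (c := b.degree = y.2), mul_zero]
        omega
      · rw [if_neg hi, zero_mul]
  rw [Finset.sum_congr rfl key]
  split_ifs <;> simp

/-- The coefficient variables of the universal circuit: kind `c`, instruction `k`, argument `j`. -/
def circuitVar (c k j : ℕ) : ℕ := Nat.pair c (Nat.pair k j)

/-- The universal polynomials for the homogeneous component of degree `d ≥ 1` of the result of
the `k`-th instruction of a straight-line program. -/
noncomputable def circuitUniversal (R : Type u) [CommRing R] (k : ℕ) : ℕ → MvPolynomial ℕ R :=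
  fun d => (if d = 1 then X (circuitVar 0 k 0) else 0) +
    ∑ j : Fin k, X (circuitVar 1 k j) * circuitUniversal R j d +
    ∑ e ∈ Finset.Ico 1 d, (∑ j : Fin k, X (circuitVar 2 k j) * circuitUniversal R j e) *
      ∑ j : Fin k, X (circuitVar 3 k j) * circuitUniversal R j (d - e)
termination_by k
decreasing_by all_goals exact j.2

/-- Generic linear combinations of the results of earlier instructions. -/
noncomputable def circuitLinear (R : Type u) [CommRing R] (c k d : ℕ) : MvPolynomial ℕ R :=
  ∑ j ∈ Finset.range k, X (circuitVar c k j) * circuitUniversal R j d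

theorem circuitUniversal_eq (R : Type u) [CommRing R] (k d : ℕ) :
    circuitUniversal R k d = (if d = 1 then X (circuitVar 0 k 0) else 0) +
      circuitLinear R 1 k d +
      ∑ e ∈ Finset.Ico 1 d, circuitLinear R 2 k e * circuitLinear R 3 k (d - e) := by
  rw [circuitUniversal]
  simp only [circuitLinear, Finset.sum_range]

/-- The universal family for circuits. -/
noncomputable def circuitFamily (R : Type u) [CommRing R] : Family R := fun n =>
  X (circuitVar 4 0 0) + ∑ d ∈ Finset.Icc 1 n, circuitUniversal R n d

theorem map_circuitUniversal {R S : Type u} [CommRing R] [CommRing S] (φ : R →+* S) (k d : ℕ) :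
    map φ (circuitUniversal R k d) = circuitUniversal S k d := by
  induction k using Nat.strong_induction_on generalizing d with
  | _ k ih =>
    have hlin : ∀ c d, map φ (circuitLinear R c k d) = circuitLinear S c k d := by
      intro c d
      rw [circuitLinear, circuitLinear, map_sum]
      refine Finset.sum_congr rfl fun j hj => ?_
      rw [map_mul, map_X, ih j (Finset.mem_range.1 hj)]
    rw [circuitUniversal_eq, circuitUniversal_eq, map_add, map_add, map_sum, hlin]
    congr 2
    · split_ifs <;> simp
    · simp only [map_mul, hlin]

theorem map_circuitFamily {R S : Type u} [CommRing R] [CommRing S] (φ : R →+* S) (n : ℕ) :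
    map φ (circuitFamily R n) = circuitFamily S n := by
  simp only [circuitFamily, map_add, map_X, map_sum, map_circuitUniversal]

/-- Both factors in the products have positive degrees `e` and `d - e`, and `(2e - 1) + (2(d - e) -
1) < 2d - 1`. So multiplications are charged to `d`, and the bound grows only linearly in `k`. -/
theorem circuitUniversal_totalDegree_le (R : Type u) [CommRing R] (k d : ℕ) (hd : 1 ≤ d) :
    (circuitUniversal R k d).totalDegree ≤ (2 * d - 1) * (k + 1) := by
  induction k using Nat.strong_induction_on generalizing d with
  | _ k ih =>
    have hlin : ∀ c d, 1 ≤ d → (circuitLinear R c k d).totalDegree ≤ (2 * d - 1) * k + 1 := by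
      intro c d hd
      refine (totalDegree_finsetSum _ _).trans (Finset.sup_le fun j hj => ?_)
      have hj := Finset.mem_range.1 hj
      refine (totalDegree_mul _ _).trans ?_
      have h₁ := totalDegree_X_le (R := R) (circuitVar c k j)
      have h₂ := ih j hj d hd
      have h₃ : (2 * d - 1) * (j + 1) ≤ (2 * d - 1) * k := Nat.mul_le_mul_left _ hj
      omega
    rw [circuitUniversal_eq]
    have hmono : (2 * d - 1) * k + 1 ≤ (2 * d - 1) * (k + 1) := by
      rw [mul_add]
      omega
    refine (totalDegree_add _ _).trans (max_le ((totalDegree_add _ _).trans (max_le ?_ ?_)) ?_)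
    · split_ifs
      · exact (totalDegree_X_le _).trans (by omega)
      · simp
    · exact (hlin 1 d hd).trans hmono
    · refine (totalDegree_finsetSum _ _).trans (Finset.sup_le fun e he => ?_)
      obtain ⟨he₁, he₂⟩ := Finset.mem_Ico.1 he
      refine (totalDegree_mul _ _).trans
        ((add_le_add (hlin 2 e he₁) (hlin 3 (d - e) (by omega))).trans ?_)
      obtain ⟨a, rfl⟩ := Nat.exists_eq_add_of_le he₁
      obtain ⟨b, rfl⟩ := Nat.exists_eq_add_of_lt he₂
      rw [show 1 + a + b + 1 - (1 + a) = b + 1 by omega,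
        show 2 * (1 + a) - 1 = 2 * a + 1 by omega, show 2 * (b + 1) - 1 = 2 * b + 1 by omega,
        show 2 * (1 + a + b + 1) - 1 = 2 * a + 2 * b + 3 by omega]
      nlinarith

section

variable {K : Type u} [Field K]

/-- A bound for the cost of one instruction of the universal circuit. -/
def circuitCost (M E : ℕ) : ℕ :=
  4 * M + 1 + 4 * M * E + 4 * E * (M + 1) + E * E + E * (E + 1) + E + E

theorem circuitUniversal_comp (N D k : ℕ) (hk : k ≤ N + 1) :
    Comp False (k * circuitCost (N + 1) (D + 1))
      {p | ∃ j < k, ∃ d ≤ D, p = circuitUniversal K j d} := by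
  induction k with
  | zero => simpa using Comp.empty
  | succ k ih =>
    set E := Finset.range (D + 1) with hE
    -- The blocks `h₁` to `h₈` account, in this order, for the summands of `circuitCost`.
    have h₁ := (ih (by omega)).insert_image (Finset.range 4 ×ˢ Finset.range (k + 1))
      (fun x => X (circuitVar x.1 k x.2)) fun x _ => Or.inl (isSimple_X _)
    -- The zero serves as the first summand of the components of degree other than `1`.
    have h₂ := h₁.insert (p := 0) (Or.inl isSimple_zero)
    have h₃ := h₂.insert_image ((Finset.range 4 ×ˢ Finset.range k) ×ˢ E)
      (fun x => X (circuitVar x.1.1 k x.1.2) * circuitUniversal K x.1.2 x.2) fun x hx => by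
        simp only [hE, Finset.mem_product, Finset.mem_range] at hx
        refine Step.mul (Or.inr (Or.inr ⟨x.1, ?_, rfl⟩))
          (Or.inr (Or.inl ⟨x.1.2, hx.1.2, x.2, by omega, rfl⟩)) False.elim
        simp only [Finset.coe_product, Set.mem_prod, Finset.coe_range, Set.mem_Iio]
        omega
    have h₄ := h₃.union_image (Finset.range 4 ×ˢ E) (fun x => circuitLinear K x.1 k x.2) (k + 1)
      fun x hx n' S' hS hc => by
        have := hc.insert_sum (Finset.range k)
          (fun j => X (circuitVar x.1 k j) * circuitUniversal K j x.2) fun j hj => hS (Or.inr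
            ⟨((x.1, j), x.2), by simp_all, rfl⟩)
        rwa [Finset.card_range] at this
    have h₅ := h₄.insert_image (E ×ˢ E)
      (fun x => circuitLinear K 2 k x.1 * circuitLinear K 3 k x.2) fun x hx => by
        rw [Finset.mem_product] at hx
        exact Step.mul (Or.inr ⟨(2, x.1), by simp [hx.1], rfl⟩)
          (Or.inr ⟨(3, x.2), by simp [hx.2], rfl⟩) False.elim
    have h₆ := h₅.union_image E (fun d => ∑ e ∈ Finset.Ico 1 d,
        circuitLinear K 2 k e * circuitLinear K 3 k (d - e)) (D + 1 + 1)
      fun d hd n' S' hS hc => by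
        have hd := Finset.mem_range.1 hd
        have := hc.insert_sum (Finset.Ico 1 d)
          (fun e => circuitLinear K 2 k e * circuitLinear K 3 k (d - e)) fun e he => hS (Or.inr
            ⟨(e, d - e), by simp [hE] at he ⊢; omega, rfl⟩)
        refine this.mono ?_
        rw [Nat.card_Ico]
        omega
    have h₇ := h₆.insert_image E (fun d => (if d = 1 then X (circuitVar 0 k 0) else 0) +
        circuitLinear K 1 k d) fun d hd => by
      refine Step.add (Or.inl (Or.inl (Or.inl (Or.inl ?_))))
        (Or.inl (Or.inl (Or.inr ⟨(1, d), by simp [hd], rfl⟩)))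
      split_ifs
      · exact Or.inr (Or.inr ⟨(0, 0), by simp, rfl⟩)
      · exact Or.inl rfl
    have h₈ := h₇.insert_image E (fun d => circuitUniversal K k d) fun d hd => by
      rw [circuitUniversal_eq]
      exact Step.add (Or.inr ⟨d, hd, rfl⟩) (Or.inl (Or.inr ⟨d, hd, rfl⟩))
    refine (h₈.mono ?_).subset ?_
    · simp only [hE, Finset.card_product, Finset.card_range]
      have : circuitCost (k + 1) (D + 1) ≤ circuitCost (N + 1) (D + 1) := by
        unfold circuitCost
        gcongr
      refine le_trans ?_ ((Nat.add_le_add_left this _).trans (Nat.succ_mul k _).ge)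
      unfold circuitCost
      nlinarith
    · rintro _ ⟨j, hj, d, hd, rfl⟩
      rcases (Nat.lt_succ_iff.1 hj).eq_or_lt with rfl | hj
      · exact Or.inr ⟨d, by simp [hE]; omega, rfl⟩
      · exact Or.inl (Or.inl (Or.inl (Or.inl (Or.inl (Or.inl (Or.inr (Or.inl
          ⟨j, hj, d, hd, rfl⟩)))))))

theorem circuitFamily_compLE (n : ℕ) :
    CompLE False K (circuitFamily K n)
      ((n + 1) * circuitCost (n + 1) (n + 1) + (n + 1) + 1 + 1) := by
  have h := circuitUniversal_comp (K := K) n n (n + 1) le_rfl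
  have h₁ := h.insert_sum (Finset.Icc 1 n) (fun d => circuitUniversal K n d) fun d hd =>
    ⟨n, by omega, d, (Finset.mem_Icc.1 hd).2, rfl⟩
  have h₂ := h₁.insert (p := X (circuitVar 4 0 0)) (Or.inl (isSimple_X _))
  have h₃ := h₂.insert (p := circuitFamily K n) (Step.add (Or.inl rfl) (Or.inr (Or.inl rfl)))
  refine (h₃.mono ?_).subset (by simp)
  simp

theorem circuitFamily_mem : circuitFamily K ∈ classOf (CompLE False) K := by
  have hn : PolyBounded (fun n => n + 1) := PolyBounded.id.add (.const 1)
  have hn' : PolyBounded (fun n => n + 1 + 1) := hn.add (.const 1)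
  have h4 : PolyBounded (fun _ => 4) := .const 4
  have hs : PolyBounded (fun n => (n + 1) * circuitCost (n + 1) (n + 1) + (n + 1) + 1 + 1) := by
    unfold circuitCost
    exact ((((hn.mul ((((((((h4.mul hn).add (.const 1)).add ((h4.mul hn).mul hn)).add
      ((h4.mul hn).mul hn')).add (hn.mul hn)).add (hn.mul hn')).add hn).add hn)).add hn).add
      (.const 1)).add (.const 1))
  refine ⟨⟨hs.mono fun n => Comp.vars_card_le (circuitFamily_compLE n) rfl,
    ((PolyBounded.const 2).mul (hn.mul hn)).mono fun n => ?_⟩, _, hs, circuitFamily_compLE⟩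
  refine (totalDegree_add _ _).trans (max_le ((totalDegree_X_le _).trans (by nlinarith)) ?_)
  refine (totalDegree_finsetSum _ _).trans (Finset.sup_le fun d hd => ?_)
  obtain ⟨h₁, h₂⟩ := Finset.mem_Icc.1 hd
  refine (circuitUniversal_totalDegree_le K n d h₁).trans ?_
  rw [← mul_assoc]
  exact Nat.mul_le_mul_right _ (by omega)

/-- The coefficients that make the universal circuit follow a given instruction. -/
theorem Step.exists_coefficients {v : ℕ → MvPolynomial ℕ K} {k : ℕ}
    (h : Step False (v '' Set.Iio k) (v k)) :
    ∃ (z : MvPolynomial ℕ K) (y a b : ℕ → K), IsSimple z ∧ ∀ d, 1 ≤ d →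
      homogeneousComponent d (v k) = (if d = 1 then z else 0) +
        ∑ j ∈ Finset.range k, C (y j) * homogeneousComponent d (v j) +
        ∑ e ∈ Finset.Ico 1 d, (∑ j ∈ Finset.range k, C (a j) * homogeneousComponent e (v j)) *
          ∑ j ∈ Finset.range k, C (b j) * homogeneousComponent (d - e) (v j) := by
  have delta : ∀ i < k, ∀ (c : K) (d : ℕ),
      ∑ j ∈ Finset.range k, C (if j = i then c else 0) * homogeneousComponent d (v j) =
        C c * homogeneousComponent d (v i) := by
    intro i hi c d
    rw [Finset.sum_eq_single i]
    · simp
    · intro j _ hj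
      simp [hj]
    · simp [hi]
  rcases h with (⟨j, h⟩ | ⟨c, h⟩) | ⟨_, ⟨i, hi, rfl⟩, _, ⟨j, hj, rfl⟩, h⟩ |
    ⟨_, ⟨i, hi, rfl⟩, _, ⟨j, hj, rfl⟩, -, h⟩
  · refine ⟨X j, 0, 0, 0, isSimple_X j, fun d hd => ?_⟩
    rw [h, homogeneousComponent_of_mem (isHomogeneous_X K j)]
    simp
  -- A constant has no component of positive degree; constants only matter as coefficients in later
  -- products.
  · refine ⟨0, 0, 0, 0, isSimple_zero, fun d hd => ?_⟩
    rw [h, homogeneousComponent_eq_zero _ _ (by rw [totalDegree_C]; exact hd)]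
    simp
  · refine ⟨0, fun l => (if l = i then 1 else 0) + (if l = j then 1 else 0), 0, 0,
      isSimple_zero, fun d hd => ?_⟩
    simp only [C_add, add_mul, Finset.sum_add_distrib, delta i hi, delta j hj, h]
    simp
  -- The extreme terms `e = 0` and `e = d` of the product contain a constant term as a factor, and
  -- so belong to the linear part. Only `0 < e < d` remains as a genuine product.
  · refine ⟨0, fun l => (if l = j then coeff 0 (v i) else 0) +
      (if l = i then coeff 0 (v j) else 0), fun l => if l = i then 1 else 0,
      fun l => if l = j then 1 else 0, isSimple_zero, fun d hd => ?_⟩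
    simp only [C_add, add_mul, Finset.sum_add_distrib, delta i hi, delta j hj, h]
    rw [homogeneousComponent_mul, Finset.Nat.sum_antidiagonal_eq_sum_range_succ
      (fun x y => homogeneousComponent x (v i) * homogeneousComponent y (v j)),
      Finset.sum_range_succ, Finset.range_eq_Ico, Finset.sum_eq_sum_Ico_succ_bot (by omega)]
    simp
    ring

/-- With the coefficients of the given program, the universal circuit yields the components of `p`
of degrees `1` to `n`. As the degree is at most `n`, only the constant term is missing, and the
extra variable supplies it. -/
theorem CompLE.isProjection_circuitFamily {p : MvPolynomial ℕ K} {n : ℕ}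
    (h : CompLE False K p n) (hdeg : p.totalDegree ≤ n) :
    IsProjection p (circuitFamily K n) := by
  obtain ⟨v, hv, hS⟩ := h
  obtain ⟨r, hr, rfl⟩ := hS rfl
  have hr : r < n := hr
  set w := Function.update v n (v r) with hw
  have hwn : w n = v r := Function.update_self _ _ _
  have hlt : ∀ k < n, w k = v k := fun k hk => Function.update_of_ne hk.ne _ _
  have himg : ∀ k ≤ n, w '' Set.Iio k = v '' Set.Iio k := fun k hk =>
    Set.image_congr fun i hi => hlt i ((Set.mem_Iio.1 hi).trans_le hk)
  have hco : ∀ k, ∃ (z : MvPolynomial ℕ K) (y a b : ℕ → K), IsSimple z ∧ (k ≤ n → ∀ d, 1 ≤ d →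
      homogeneousComponent d (w k) = (if d = 1 then z else 0) +
        ∑ j ∈ Finset.range k, C (y j) * homogeneousComponent d (w j) +
        ∑ e ∈ Finset.Ico 1 d, (∑ j ∈ Finset.range k, C (a j) * homogeneousComponent e (w j)) *
          ∑ j ∈ Finset.range k, C (b j) * homogeneousComponent (d - e) (w j)) := by
    intro k
    rcases lt_trichotomy k n with hk | rfl | hk
    · obtain ⟨z, y, a, b, hz, h⟩ := Step.exists_coefficients (v := w) (k := k) (by
        rw [himg k hk.le, hlt k hk]
        exact hv k hk)
      exact ⟨z, y, a, b, hz, fun _ => h⟩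
    · refine ⟨0, fun j => if j = r then 1 else 0, 0, 0, isSimple_zero, fun _ d hd => ?_⟩
      rw [Finset.sum_eq_single r]
      · simp [hwn, hlt r hr]
      · intro j _ hj
        simp [hj]
      · simp [hr]
    · exact ⟨0, 0, 0, 0, isSimple_zero, fun h => by omega⟩
  choose z y a b hz hstep using hco
  let α : ℕ → MvPolynomial ℕ K := fun i =>
    let k := i.unpair.2.unpair.1
    let j := i.unpair.2.unpair.2
    match i.unpair.1 with
    | 0 => z k
    | 1 => C (y k j)
    | 2 => C (a k j)
    | 3 => C (b k j)
    | _ => C (coeff 0 (v r))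
  have hα : ∀ c k j, α (circuitVar c k j) = match c with
      | 0 => z k
      | 1 => C (y k j)
      | 2 => C (a k j)
      | 3 => C (b k j)
      | _ => C (coeff 0 (v r)) := fun c k j => by
    simp only [α, circuitVar, Nat.unpair_pair]
  have key : ∀ k ≤ n, ∀ d, 1 ≤ d →
      aeval α (circuitUniversal K k d) = homogeneousComponent d (w k) := by
    intro k
    induction k using Nat.strong_induction_on with
    | _ k ih =>
      intro hk d hd
      have hlin : ∀ c d, 1 ≤ d → aeval α (circuitLinear K c k d) =
          ∑ j ∈ Finset.range k, α (circuitVar c k j) * homogeneousComponent d (w j) := by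
        intro c d hd
        rw [circuitLinear, map_sum]
        refine Finset.sum_congr rfl fun j hj => ?_
        have hj := Finset.mem_range.1 hj
        rw [map_mul, aeval_X, ih j hj (by omega) d hd]
      rw [circuitUniversal_eq, hstep k hk d hd, map_add, map_add, map_sum, hlin 1 d hd]
      simp only [hα]
      refine congrArg₂ _ (congrArg₂ _ ?_ rfl) (Finset.sum_congr rfl fun e he => ?_)
      · split_ifs
        · exact (aeval_X _ _).trans (hα 0 k 0)
        · exact map_zero _
      · obtain ⟨he₁, he₂⟩ := Finset.mem_Ico.1 he
        rw [map_mul, hlin 2 e he₁, hlin 3 (d - e) (by omega)]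
        simp only [hα]
  refine isProjection_iff.2 ⟨α, fun i => ?_, ?_⟩
  · simp only [α]
    split
    exacts [hz _, isSimple_C _, isSimple_C _, isSimple_C _, isSimple_C _]
  · rw [circuitFamily, map_add, map_sum, aeval_X, hα]
    conv_lhs => rw [← sum_homogeneousComponent (v r)]
    rw [Finset.sum_subset (s₂ := Finset.range (n + 1)) (by
        intro d hd
        simp at hd ⊢
        omega) (by
        intro d _ hd
        exact homogeneousComponent_eq_zero _ _ (by simp at hd; omega)),
      Finset.range_eq_Ico, Finset.sum_eq_sum_Ico_succ_bot (by omega), homogeneousComponent_zero]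
    refine congrArg₂ _ rfl (Finset.sum_congr (by ext; simp) fun d hd => ?_)
    rw [key n le_rfl d (Finset.mem_Icc.1 hd).1, hwn]

end

theorem isDenseIn_VP (K : Type u) [Field K] (r : ReductionKind) :
    IsDenseIn (Complete VP r) VP K := by
  rw [VP_eq]
  refine isDenseIn_complete (isMeasure_compLE False) _ (circuitFamily _)
    (fun n => map_circuitFamily _ _) circuitFamily_mem (fun g ⟨hg, s, hs, h⟩ => ?_) r
  -- The index of the universal family has to bound both the size and the degree.
  exact ⟨_, hs.max hg.2, fun n => CompLE.isProjection_circuitFamily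
    (Comp.mono (h n) (le_max_left _ _)) (le_max_right _ _)⟩

/-! ### Hamiltonian cycle sums -/

section HamiltonSum

variable {α β : Type} [Fintype α] [DecidableEq α] [Fintype β] [DecidableEq β]
  {R : Type*} [CommRing R]

open Classical in
/-- The sum of the weights of all Hamiltonian cycles of the complete digraph on `α` with
edge weights `M`. -/
noncomputable def hamiltonSum (M : α → α → R) : R :=
  ∑ π ∈ Finset.univ.filter (fun π : Equiv.Perm α => π.IsCycleOn Set.univ), ∏ i, M i (π i)

open Classical in
theorem hamiltonSum_eq (M : α → α → R) : hamiltonSum M =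
    ∑ π : Equiv.Perm α, if π.IsCycleOn Set.univ then ∏ i, M i (π i) else 0 := by
  rw [hamiltonSum, Finset.sum_filter]

theorem HC_eq (K : Type u) [Field K] (n : ℕ) :
    HC K n = hamiltonSum fun i j : Fin n => X (Nat.pair i j) := by
  rfl

theorem map_hamiltonSum {S F : Type*} [CommRing S] [FunLike F R S] [RingHomClass F R S]
    (φ : F) (M : α → α → R) :
    φ (hamiltonSum M) = hamiltonSum fun i j => φ (M i j) := by
  simp only [hamiltonSum, map_sum, map_prod]

/-- A permutation is a single cycle if no nonempty proper subset is invariant; by finiteness forward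
invariance suffices. This form is easily transported along bijections and through the removal of a
vertex. -/
theorem isCycleOn_univ_iff {γ : Type*} [Finite γ] (σ : Equiv.Perm γ) :
    σ.IsCycleOn Set.univ ↔ ∀ P : γ → Prop, (∀ x, P x → P (σ x)) → ∀ x y, P x → P y := by
  constructor
  · intro h P hP x y hx
    obtain ⟨k, hk⟩ := (h.2 (Set.mem_univ x) (Set.mem_univ y)).exists_nat_pow_eq
    rw [← hk]
    clear hk
    induction k with
    | zero => exact hx
    | succ k ih =>
      rw [pow_succ']
      exact hP _ ih
  · intro h
    refine ⟨by simpa using σ.bijective, fun x _ y _ => ?_⟩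
    exact h (fun z => σ.SameCycle x z) (fun z hz => Equiv.Perm.sameCycle_apply_right.2 hz) x y
      (Equiv.Perm.SameCycle.refl σ x)

theorem hamiltonSum_equiv (e : α ≃ β) (M : β → β → R) :
    hamiltonSum (fun i j => M (e i) (e j)) = hamiltonSum M := by
  classical
  rw [hamiltonSum_eq, hamiltonSum_eq, ← Equiv.sum_comp e.permCongr]
  refine Finset.sum_congr rfl fun σ _ => ?_
  have hcyc : (e.permCongr σ).IsCycleOn Set.univ ↔ σ.IsCycleOn Set.univ := by
    simp only [isCycleOn_univ_iff]
    constructor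
    · intro h P hP x y hx
      have := h (fun z => P (e.symm z)) (fun z hz => by simpa using hP _ hz) (e x) (e y)
        (by simpa using hx)
      simpa using this
    · intro h P hP x y hx
      have := h (fun z => P (e z)) (fun z hz => by simpa using hP _ hz) (e.symm x) (e.symm y)
        (by simpa using hx)
      simpa using this
  simp only [hcyc]
  congr 1
  rw [← Equiv.prod_comp e]
  simp

theorem hamiltonSum_of_isEmpty [IsEmpty α] (M : α → α → R) : hamiltonSum M = 1 := by
  simp [hamiltonSum_eq, Equiv.Perm.isCycleOn_of_subsingleton]

theorem hamiltonSum_unique [Unique α] (M : α → α → R) : hamiltonSum M = M default default := by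
  simp [hamiltonSum_eq, Equiv.Perm.isCycleOn_of_subsingleton]

theorem decomposeOption_symm_none {γ : Type*} [DecidableEq γ] (u : Option γ)
    (τ : Equiv.Perm γ) :
    Equiv.Perm.decomposeOption.symm (u, τ) none = u := by
  simp [Equiv.Perm.decomposeOption]

theorem decomposeOption_symm_some {γ : Type*} [DecidableEq γ] (a : γ) (τ : Equiv.Perm γ)
    (i : γ) :
    Equiv.Perm.decomposeOption.symm (some a, τ) (some i) =
      if τ i = a then none else some (τ i) := by
  simp only [Equiv.Perm.decomposeOption_symm_apply, Equiv.Perm.coe_mul, Function.comp,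
    Equiv.optionCongr_apply, Option.map_some]
  split_ifs with h
  · rw [h, Equiv.swap_apply_right]
  · exact Equiv.swap_apply_of_ne_of_ne (by simp) (by simpa using h)

theorem not_isCycleOn_decomposeOption_none [Nonempty α] (τ : Equiv.Perm α) :
    ¬ (Equiv.Perm.decomposeOption.symm (none, τ)).IsCycleOn Set.univ := by
  rw [isCycleOn_univ_iff]
  intro h
  obtain ⟨a⟩ := ‹Nonempty α›
  have := h (fun o => o = none) (fun o ho => by rw [ho, decomposeOption_symm_none]) none (some a)
    rfl
  simp at this

/-- The permutation arises from `τ` by inserting `none` into the edge that enters `a`, which does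
not change the number of cycles. -/
theorem isCycleOn_decomposeOption_some (a : α) (τ : Equiv.Perm α) :
    (Equiv.Perm.decomposeOption.symm (some a, τ)).IsCycleOn Set.univ ↔
      τ.IsCycleOn Set.univ := by
  simp only [isCycleOn_univ_iff]
  set σ := Equiv.Perm.decomposeOption.symm (some a, τ) with hσ
  have hnone : σ none = some a := decomposeOption_symm_none _ _
  have hsome : ∀ i, σ (some i) = if τ i = a then none else some (τ i) :=
    decomposeOption_symm_some a τ
  constructor
  · intro h P hP x y hx
    -- An invariant property of `τ` extends to `none` by its value at the successor `a`.
    refine h (fun o => o.elim (P a) P) (fun o ho => ?_) (some x) (some y) hx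
    rcases o with _ | i
    · rw [hnone]
      exact ho
    · rw [hsome]
      have hi : P (τ i) := hP i ho
      split_ifs with hia
      · rwa [hia] at hi
      · exact hi
  · intro h P hP
    have hstep : ∀ i, P (some i) → P (some (τ i)) := by
      intro i hi
      have h₁ := hP _ hi
      rw [hsome] at h₁
      split_ifs at h₁ with hia
      · have := hP _ h₁
        rwa [hnone, ← hia] at this
      · exact h₁
    have hall := h (fun i => P (some i)) hstep
    have hto : ∀ o, P o → P (some a) := by
      rintro (_ | i) hi
      · have := hP _ hi
        rwa [hnone] at this
      · exact hall i a hi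
    intro o o' ho
    rcases o' with _ | j
    · have := hP _ (hall a (τ.symm a) (hto o ho))
      rwa [hsome, if_pos (by simp)] at this
    · exact hall a j (hto o ho)

/-- Expansion along the predecessor of the additional vertex `none`. -/
theorem hamiltonSum_option [Nonempty α] (M : Option α → Option α → R) :
    hamiltonSum M = ∑ w, M (some w) none *
      hamiltonSum fun i j => if i = w then M none (some j) else M (some i) (some j) := by
  classical
  rw [hamiltonSum_eq, ← Equiv.sum_comp Equiv.Perm.decomposeOption.symm, Fintype.sum_prod_type,
    Fintype.sum_option, Finset.sum_eq_zero, zero_add, Finset.sum_comm]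
  swap
  · exact fun τ _ => if_neg (not_isCycleOn_decomposeOption_none τ)
  simp only [hamiltonSum_eq, Finset.mul_sum]
  rw [Finset.sum_comm (s := Finset.univ (α := α))]
  refine Finset.sum_congr rfl fun τ _ => ?_
  -- The successor of `none` is written as `τ w`, so that `w` is its predecessor: the edge from `w`
  -- to `τ w` has been replaced by a path through `none`.
  rw [← Equiv.sum_comp τ]
  refine Finset.sum_congr rfl fun w _ => ?_
  simp only [isCycleOn_decomposeOption_some]
  split_ifs with hτ
  swap
  · simp
  rw [Fintype.prod_option, decomposeOption_symm_none]
  simp only [decomposeOption_symm_some, τ.injective.eq_iff]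
  rw [← Finset.mul_prod_erase _ _ (Finset.mem_univ w),
    ← Finset.mul_prod_erase _ _ (Finset.mem_univ w), if_pos rfl, if_pos rfl, mul_left_comm]
  refine congrArg _ (congrArg _ (Finset.prod_congr rfl fun i hi => ?_))
  rw [if_neg (Finset.ne_of_mem_erase hi), if_neg (Finset.ne_of_mem_erase hi)]

/-- Every Hamiltonian cycle uses exactly one edge leaving `i`, so the sum is linear in row `i`. -/
theorem hamiltonSum_row (M : α → α → R) (i : α) (A B : α → R) (c : R) :
    hamiltonSum (fun x y => if x = i then A y + c * B y else M x y) =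
      hamiltonSum (fun x y => if x = i then A y else M x y) +
        c * hamiltonSum (fun x y => if x = i then B y else M x y) := by
  classical
  simp only [hamiltonSum, Finset.mul_sum, ← Finset.sum_add_distrib]
  refine Finset.sum_congr rfl fun σ _ => ?_
  simp only [← Finset.mul_prod_erase _ _ (Finset.mem_univ i), if_pos]
  have : ∀ A : α → R, ∏ x ∈ Finset.univ.erase i, (if x = i then A (σ x) else M x (σ x)) =
      ∏ x ∈ Finset.univ.erase i, M x (σ x) := fun A =>
    Finset.prod_congr rfl fun x hx => if_neg (Finset.ne_of_mem_erase hx)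
  rw [this A, this B, this fun y => A y + c * B y]
  ring

/-- Two new vertices after `i`, which may be traversed in two orders: one of them leads to the
old successors of `i`, the other one is an edge from `i` to `j` of weight `p * q * r`. -/
def gadget (M : α → α → R) (i j : α) (p q r : R) : Option (Option α) → Option (Option α) → R
  | none, none => 0
  | none, some none => q
  | none, some (some y) => M i y
  | some none, none => 1
  | some none, some none => 0
  | some none, some (some y) => if y = j then r else 0
  | some (some x), none => if x = i then p else 0
  | some (some x), some none => if x = i then 1 else 0
  | some (some x), some (some y) => if x = i then 0 else M x y

/-- Let `u = none` and `v = some none`. They can only be entered from `i` or from each other, and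
`i` leads only to them. So a cycle contains `i → v → u → y` with weight `M i y`, or `i → u → v → j`
with weight `p * q * r`. Eliminating `u` and `v` leaves a sum of two choices of row `i`. -/
theorem hamiltonSum_gadget (M : α → α → R) (i j : α) (p q r : R) :
    hamiltonSum (gadget M i j p q r) =
      hamiltonSum fun x y => M x y + if x = i ∧ y = j then p * q * r else 0 := by
  have : Nonempty α := ⟨i⟩
  rw [hamiltonSum_option, Fintype.sum_option, Finset.sum_eq_single i, hamiltonSum_option,
    Finset.sum_eq_single i, hamiltonSum_option, Finset.sum_eq_single i]
  · have h := hamiltonSum_row M i (M i) (fun y => if y = j then r else 0) (p * q)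
    have h₁ : (fun x y => M x y + if x = i ∧ y = j then p * q * r else 0) =
        fun x y => if x = i then M i y + p * q * (if y = j then r else 0) else M x y := by
      funext x y
      by_cases hx : x = i
      · subst hx
        by_cases hy : y = j <;> simp [hy]
      · simp [hx]
    rw [h₁, h]
    simp only [gadget, reduceCtorEq, if_true, if_false, Option.some.injEq, one_mul]
    congr 1
    · congr 1
      funext x y
      by_cases hx : x = i <;> simp [hx]
    · rw [mul_assoc]
      congr 3
      funext x y
      by_cases hx : x = i <;> simp [hx]
  all_goals simp +contextual [gadget]

end HamiltonSum

/-! ### Projections of Hamiltonian cycle polynomials -/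

section Representation

variable {K : Type u} [Field K]

/-- `p` is a Hamiltonian cycle sum on `m` vertices whose weights are variables and constants. -/
def IsHamiltonSum (p : MvPolynomial ℕ K) (m : ℕ) : Prop :=
  ∃ M : Fin m → Fin m → MvPolynomial ℕ K, (∀ i j, IsSimple (M i j)) ∧ p = hamiltonSum M

theorem isHamiltonSum_of_card {α : Type} [Fintype α] [DecidableEq α] {m : ℕ}
    (hm : Fintype.card α = m) (M : α → α → MvPolynomial ℕ K) (hM : ∀ i j, IsSimple (M i j)) :
    IsHamiltonSum (hamiltonSum M) m :=
  ⟨fun i j => M ((Fintype.equivFinOfCardEq hm).symm i) ((Fintype.equivFinOfCardEq hm).symm j),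
    fun _ _ => hM _ _, (hamiltonSum_equiv _ M).symm⟩

theorem isProjection_HC_iff {p : MvPolynomial ℕ K} {m : ℕ} :
    IsProjection p (HC K m) ↔ IsHamiltonSum p m := by
  rw [isProjection_iff]
  constructor
  · rintro ⟨α, hα, rfl⟩
    refine ⟨fun i j => α (Nat.pair i j), fun i j => hα _, ?_⟩
    rw [HC_eq]
    simp only [map_hamiltonSum, aeval_X]
  · rintro ⟨M, hM, rfl⟩
    refine ⟨fun k => if h : k.unpair.1 < m ∧ k.unpair.2 < m then M ⟨_, h.1⟩ ⟨_, h.2⟩ else 0,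
      fun k => ?_, ?_⟩
    · beta_reduce
      split_ifs
      exacts [hM _ _, isSimple_zero]
    · rw [HC_eq, map_hamiltonSum]
      simp

/-- The vertex `w₀` is split: its only usable edge leads to the new vertex, which takes over its
successors. -/
theorem IsHamiltonSum.succ {p : MvPolynomial ℕ K} {m : ℕ} (h : IsHamiltonSum p m) :
    IsHamiltonSum p (m + 1) := by
  obtain ⟨M, hM, rfl⟩ := h
  -- The empty graph has no vertex to split; its sum is `1`, like that of a loop of weight `1`.
  rcases Nat.eq_zero_or_pos m with rfl | hm
  · refine ⟨fun _ _ => 1, fun _ _ => isSimple_one, ?_⟩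
    rw [hamiltonSum_of_isEmpty]
    exact (hamiltonSum_unique (α := Fin 1) fun _ _ => (1 : MvPolynomial ℕ K)).symm
  · let w₀ : Fin m := ⟨0, hm⟩
    have : Nonempty (Fin m) := ⟨w₀⟩
    let N : Option (Fin m) → Option (Fin m) → MvPolynomial ℕ K := fun x y =>
      match x, y with
      | none, none => 0
      | none, some j => M w₀ j
      | some i, none => if i = w₀ then 1 else 0
      | some i, some j => M i j
    have hN : hamiltonSum N = hamiltonSum M := by
      rw [hamiltonSum_option, Finset.sum_eq_single w₀]
      · simp only [N, if_true, one_mul]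
        congr 1
        funext i j
        split_ifs with h
        · rw [h]
        · rfl
      · intro i _ hi
        simp [N, hi]
      · simp
    rw [← hN]
    refine isHamiltonSum_of_card (by simp) N fun x y => ?_
    rcases x with _ | x <;> rcases y with _ | y
    · exact isSimple_zero
    · exact hM _ _
    · simp only [N]
      split_ifs
      exacts [isSimple_one, isSimple_zero]
    · exact hM _ _

theorem IsHamiltonSum.mono {p : MvPolynomial ℕ K} {m n : ℕ} (h : IsHamiltonSum p m)
    (hmn : m ≤ n) : IsHamiltonSum p n := by
  induction hmn with
  | refl => exact h
  | step _ ih => exact ih.succ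

theorem HC_isProjection_of_le {m n : ℕ} (h : m ≤ n) : IsProjection (HC K m) (HC K n) :=
  isProjection_HC_iff.2 (IsHamiltonSum.mono
    ⟨_, fun _ _ => isSimple_X _, HC_eq K m⟩ h)

theorem IsHamiltonSum.vars_card_le {p : MvPolynomial ℕ K} {m : ℕ} (h : IsHamiltonSum p m) :
    p.vars.card ≤ m * m := by
  classical
  obtain ⟨M, hM, rfl⟩ := h
  have hsub : (hamiltonSum M).vars ⊆ (Finset.univ : Finset (Fin m × Fin m)).biUnion
      fun x => (M x.1 x.2).vars := by
    refine (vars_sum_subset _ _).trans (Finset.biUnion_subset.2 fun σ _ => ?_)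
    refine (vars_prod _).trans (Finset.biUnion_subset.2 fun i _ => ?_)
    exact Finset.subset_biUnion_of_mem (fun x : Fin m × Fin m => (M x.1 x.2).vars)
      (Finset.mem_univ (i, σ i))
  refine (Finset.card_le_card hsub).trans (Finset.card_biUnion_le.trans ?_)
  refine (Finset.sum_le_card_nsmul _ _ 1 fun x _ => (hM _ _).vars_card_le).trans ?_
  simp

theorem IsHamiltonSum.totalDegree_le {p : MvPolynomial ℕ K} {m : ℕ} (h : IsHamiltonSum p m) :
    p.totalDegree ≤ m := by
  classical
  obtain ⟨M, hM, rfl⟩ := h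
  refine (totalDegree_finsetSum _ _).trans (Finset.sup_le fun σ _ => ?_)
  refine (totalDegree_finsetProd _ _).trans ?_
  refine (Finset.sum_le_card_nsmul _ _ 1 fun i _ => (hM _ _).totalDegree_le).trans ?_
  simp

/-- The bounds of a p-family are automatic, since a sum on `m` vertices has at most `m * m`
variables and degree at most `m`. -/
theorem mem_VNP_iff {f : Family K} :
    f ∈ VNP K ↔ ∃ t, PolyBounded t ∧ ∀ n, IsHamiltonSum (f n) (t n) := by
  constructor
  · rintro ⟨-, t, ht, h⟩
    exact ⟨t, ht, fun n => isProjection_HC_iff.1 (h n)⟩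
  · rintro ⟨t, ht, h⟩
    exact ⟨⟨(ht.mul ht).mono fun n => (h n).vars_card_le, ht.mono fun n => (h n).totalDegree_le⟩,
      t, ht, fun n => isProjection_HC_iff.2 (h n)⟩

/-! ### Weights that are sums of products -/

/-- Adds the weights `p * q * r` at the entries `(i, j)` for all `(i, j, p, q, r)` in the list. -/
def addEntries {α : Type} {R : Type*} [DecidableEq α] [CommRing R] (M : α → α → R)
    (L : List (α × α × R × R × R)) : α → α → R := fun x y =>
  M x y + (L.map fun e => if x = e.1 ∧ y = e.2.1 then e.2.2.1 * e.2.2.2.1 * e.2.2.2.2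
    else 0).sum

/-- The gadget moves the outgoing edges of `i` to `none`, so pending entries in row `i` move along.
-/
theorem gadget_addEntries {α : Type} {R : Type*} [DecidableEq α] [CommRing R]
    (M : α → α → R) (L : List (α × α × R × R × R)) (i j : α) (p q r : R) :
    gadget (addEntries M L) i j p q r = addEntries (gadget M i j p q r)
      (L.map fun e => (if e.1 = i then none else some (some e.1), some (some e.2.1), e.2.2)) := by
  funext x y
  simp only [addEntries, List.map_map, Function.comp_def]
  rcases x with _ | _ | x <;> rcases y with _ | _ | y
  · simp [gadget]
  · simp [gadget]
  · simp only [gadget, addEntries, Option.some.injEq, add_right_inj]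
    congr 1
    refine List.map_congr_left fun e _ => ?_
    by_cases h : e.1 = i
    · simp [h]
    · simp [h, Ne.symm h]
  · simp [gadget]
  · simp [gadget]
  · have : ∀ e : α × α × R × R × R,
        (some none = if e.1 = i then none else some (some e.1)) ↔ False := fun e => by
      split_ifs <;> simp
    simp [gadget, this]
  · simp [gadget]
  · simp [gadget]
  · simp only [gadget, addEntries, Option.some.injEq]
    by_cases hx : x = i
    · have : ∀ e : α × α × R × R × R,
          (some (some x) = if e.1 = i then none else some (some e.1)) ↔ False := fun e => by
        split_ifs with h
        · simp
        · simpa [hx] using Ne.symm h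
      simp only [this, if_pos hx, false_and, if_false, List.map_const', List.sum_replicate,
        smul_zero, add_zero]
    · simp only [hx, if_false, add_right_inj]
      congr 1
      refine List.map_congr_left fun e _ => ?_
      by_cases h : e.1 = i
      · have : x ≠ e.1 := fun h' => hx (h'.trans h)
        simp [h, hx]
      · simp [h]

/-- Each entry of the list is traded for a gadget with two vertices, whose weights are simple again.
-/
theorem isHamiltonSum_addEntries {α : Type} [Fintype α] [DecidableEq α]
    (M : α → α → MvPolynomial ℕ K) (hM : ∀ i j, IsSimple (M i j))
    (L : List (α × α × MvPolynomial ℕ K × MvPolynomial ℕ K × MvPolynomial ℕ K))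
    (hL : ∀ e ∈ L, IsSimple e.2.2.1 ∧ IsSimple e.2.2.2.1 ∧ IsSimple e.2.2.2.2) :
    IsHamiltonSum (hamiltonSum (addEntries M L)) (Fintype.card α + 2 * L.length) := by
  classical
  induction hl : L.length generalizing α with
  | zero =>
    obtain rfl := List.length_eq_zero_iff.1 hl
    refine isHamiltonSum_of_card (by simp) _ fun i j => ?_
    simpa [addEntries] using hM i j
  | succ k ih =>
    obtain ⟨⟨i, j, p, q, r⟩, L, rfl⟩ := List.exists_cons_of_length_eq_add_one hl
    obtain ⟨hp, hq, hr⟩ := hL (i, j, p, q, r) (by simp)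
    have h₁ : hamiltonSum (addEntries M ((i, j, p, q, r) :: L)) =
        hamiltonSum (gadget (addEntries M L) i j p q r) := by
      rw [hamiltonSum_gadget]
      congr 1
      funext x y
      simp only [addEntries, List.map_cons, List.sum_cons]
      ring
    rw [h₁, gadget_addEntries]
    have := ih (gadget M i j p q r) ?_
      (L.map fun e => (if e.1 = i then none else some (some e.1), some (some e.2.1), e.2.2))
      ?_ (by simpa using hl)
    · convert this using 1
      simp only [Fintype.card_option]
      ring
    · intro x y
      rcases x with _ | _ | x <;> rcases y with _ | _ | y <;> simp only [gadget] <;>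
        (try split_ifs) <;>
        first
        | exact isSimple_zero
        | exact isSimple_one
        | exact hM _ _
        | assumption
    · intro e he
      obtain ⟨e', he', rfl⟩ := List.mem_map.1 he
      exact hL e' (by simp [he'])

theorem isHamiltonSum_add_mul {m : ℕ} (M p q r p' q' r' : Fin m → Fin m → MvPolynomial ℕ K)
    (hM : ∀ i j, IsSimple (M i j)) (hp : ∀ i j, IsSimple (p i j)) (hq : ∀ i j, IsSimple (q i j))
    (hr : ∀ i j, IsSimple (r i j)) (hp' : ∀ i j, IsSimple (p' i j))
    (hq' : ∀ i j, IsSimple (q' i j)) (hr' : ∀ i j, IsSimple (r' i j)) :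
    IsHamiltonSum (hamiltonSum fun i j =>
      M i j + p i j * q i j * r i j + p' i j * q' i j * r' i j) (m + 4 * (m * m)) := by
  let P : List (Fin m × Fin m) := Finset.univ.toList
  have hlen : P.length = m * m := by simp [P]
  have h := isHamiltonSum_addEntries M hM
    -- Two lists of `m * m` entries, with two new vertices per entry, account for `4 * (m * m)`.
    (P.map (fun x => (x.1, x.2, p x.1 x.2, q x.1 x.2, r x.1 x.2)) ++
      P.map (fun x => (x.1, x.2, p' x.1 x.2, q' x.1 x.2, r' x.1 x.2))) (by
    intro e he
    rcases List.mem_append.1 he with he | he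
    · obtain ⟨x, -, rfl⟩ := List.mem_map.1 he
      exact ⟨hp _ _, hq _ _, hr _ _⟩
    · obtain ⟨x, -, rfl⟩ := List.mem_map.1 he
      exact ⟨hp' _ _, hq' _ _, hr' _ _⟩)
  have hsum : ∀ (F : Fin m → Fin m → MvPolynomial ℕ K) (x y : Fin m),
      (P.map fun e => if x = e.1 ∧ y = e.2 then F e.1 e.2 else 0).sum = F x y := by
    intro F x y
    rw [Finset.sum_map_toList, Finset.sum_eq_single (x, y)]
    · simp
    · rintro ⟨a, b⟩ _ hne
      rw [if_neg]
      rintro ⟨rfl, rfl⟩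
      exact hne rfl
    · simp
  convert h using 1
  · congr 1
    funext x y
    simp only [addEntries, List.map_append, List.map_map, Function.comp_def, List.sum_append]
    rw [hsum (fun a b => p a b * q a b * r a b), hsum (fun a b => p' a b * q' a b * r' a b),
      add_assoc]
  · simp only [List.length_append, List.length_map, hlen, Fintype.card_fin]
    ring

end Representation

/-! ### Density of complete and of incomplete families in VNP -/

section Density

variable {K : Type u} [Field K]

/-- Every polynomial in VNP has a perturbation in VNP that projects to the Hamiltonian cycle
polynomial. -/
theorem exists_perturb_HC_isProjection {f : MvPolynomial ℕ K} {m : ℕ} (hf : IsHamiltonSum f m) :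
    ∃ g, IsHamiltonSum (perturb f g) (m + 4 * (m * m)) ∧
      IsProjection (HC (RatFunc K) m) (perturb f g) := by
  obtain ⟨M, hM, rfl⟩ := hf
  obtain ⟨B, hB⟩ : ∃ B : ℕ, ∀ i j, ∀ x ∈ (M i j).vars, x < B := by
    refine ⟨(Finset.univ : Finset (Fin m × Fin m)).sup
      (fun x => (M x.1 x.2).vars.sup id) + 1, fun i j x hx => Nat.lt_succ_of_le ?_⟩
    exact (Finset.le_sup (f := id) hx).trans (Finset.le_sup
      (f := fun x : Fin m × Fin m => (M x.1 x.2).vars.sup id) (Finset.mem_univ (i, j)))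
  -- The fresh variables are `B`, to become `1/ε`, and two per edge, separated by parity. The factor
  -- `X B` is needed because `X / ε` is not a legal substitution.
  let w : Fin m → Fin m → ℕ := fun i j => B + 1 + 2 * Nat.pair i j
  let v : Fin m → Fin m → ℕ := fun i j => B + 1 + (2 * Nat.pair i j + 1)
  let F : MvPolynomial ℕ (Polynomial K) := hamiltonSum fun i j =>
    map Polynomial.C (M i j) + C Polynomial.X * X B * X (w i j) + C Polynomial.X * X (v i j) * 1
  obtain ⟨g, hg⟩ : ∃ g, toRat F = perturb (hamiltonSum M) g := by
    refine exists_perturb_eq ?_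
    rw [map_hamiltonSum]
    congr 1
    funext i j
    have : (Polynomial.constantCoeff.comp Polynomial.C : K →+* K) = RingHom.id K := by
      ext
      simp
    simp [MvPolynomial.map_map, this, MvPolynomial.map_id]
  have hF : perturb (hamiltonSum M) g = hamiltonSum fun i j =>
      lift (M i j) + C RatFunc.X * X B * X (w i j) + C RatFunc.X * X (v i j) * 1 := by
    rw [← hg, map_hamiltonSum]
    congr 1
    funext i j
    simp only [map_add, map_mul, toRat_map_C, map_C, map_X, map_one, RatFunc.algebraMap_X]
  refine ⟨g, ?_, ?_⟩
  · rw [hF]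
    exact isHamiltonSum_add_mul _ (fun _ _ => C RatFunc.X) (fun _ _ => X B) _
      (fun _ _ => C RatFunc.X) _ (fun _ _ => 1) (fun i j => (hM i j).map _)
      (fun _ _ => isSimple_C _) (fun _ _ => isSimple_X _) (fun _ _ => isSimple_X _)
      (fun _ _ => isSimple_C _) (fun _ _ => isSimple_X _) (fun _ _ => isSimple_one)
  · rw [isProjection_iff, hF]
    let a : ℕ → RatFunc K := fun k =>
      if h : k.unpair.1 < m ∧ k.unpair.2 < m then
        constantCoeff (lift (M ⟨_, h.1⟩ ⟨_, h.2⟩)) else 0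
    let α : ℕ → MvPolynomial ℕ (RatFunc K) := fun x =>
      if x < B then 0 else if x = B then C (RatFunc.X⁻¹) else
        if (x - (B + 1)) % 2 = 0 then X ((x - (B + 1)) / 2) else
          C (- (RatFunc.X⁻¹ * a ((x - (B + 1)) / 2)))
    have hα : ∀ x, IsSimple (α x) := fun x => by
      simp only [α]
      split_ifs
      exacts [isSimple_zero, isSimple_C _, isSimple_X _, isSimple_C _]
    have hαB : α B = C (RatFunc.X⁻¹) := by simp [α]
    have hαw : ∀ i j, α (w i j) = X (Nat.pair i j) := fun i j => by
      simp only [α, w]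
      rw [if_neg (by omega), if_neg (by omega), if_pos (by omega)]
      congr 1
      omega
    have hαv : ∀ i j, α (v i j) = C (- (RatFunc.X⁻¹ * constantCoeff (lift (M i j)))) :=
        fun i j => by
      simp only [α, v]
      rw [if_neg (by omega), if_neg (by omega), if_neg (by omega),
        show (B + 1 + (2 * Nat.pair i j + 1) - (B + 1)) / 2 = Nat.pair i j by omega]
      simp [a]
    refine ⟨α, hα, ?_⟩
    rw [HC_eq, map_hamiltonSum]
    congr 1
    funext i j
    have h₁ : aeval α (lift (M i j)) = C (constantCoeff (lift (M i j))) := by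
      refine aeval_eq_C_constantCoeff _ _ fun x hx => ?_
      rw [lift_vars] at hx
      exact if_pos (hB i j x hx)
    have h₂ : (C RatFunc.X * C (RatFunc.X⁻¹) : MvPolynomial ℕ (RatFunc K)) = 1 := by
      rw [← C_mul, mul_inv_cancel₀ RatFunc.X_ne_zero, C_1]
    rw [map_add, map_add, map_mul, map_mul, map_mul, map_mul, map_one, h₁, algHom_C, aeval_X,
      aeval_X, aeval_X, hαB, hαw, hαv, algebraMap_eq, C_neg, C_mul]
    -- With `c` the constant term of the weight, this is `c + ε ε⁻¹ x - ε ε⁻¹ c = x`.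
    linear_combination (C (constantCoeff (lift (M i j))) - X (Nat.pair i j)) * h₂

theorem isDenseIn_VNP (K : Type u) [Field K] (r : ReductionKind) :
    IsDenseIn (VNPC r) VNP K := by
  refine ⟨fun f hf => hf.1, fun f hf => ⟨hf.1, ?_⟩⟩
  have hpf : IsPFamily f := hf.1
  obtain ⟨t, ht, h⟩ := mem_VNP_iff.1 hf
  -- Padding to `t n + n` vertices ensures that the `n`-th Hamiltonian cycle polynomial is a
  -- projection as well.
  have hex : ∀ n, ∃ g, IsHamiltonSum (perturb (f n) g) (t n + n + 4 * ((t n + n) * (t n + n))) ∧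
      IsProjection (HC (RatFunc K) (t n + n)) (perturb (f n) g) := fun n =>
    exists_perturb_HC_isProjection ((h n).mono (Nat.le_add_right _ _))
  choose g hg hHC using hex
  have hm : PolyBounded fun n => t n + n := ht.add .id
  have hF : (fun n => perturb (f n) (g n)) ∈ VNP (RatFunc K) :=
    mem_VNP_iff.2 ⟨_, hm.add ((PolyBounded.const 4).mul (hm.mul hm)), hg⟩
  have hred : PProjection (HC (RatFunc K)) fun n => perturb (f n) (g n) :=
    ⟨fun n => n, .id, fun n => (HC_isProjection_of_le (Nat.le_add_left n (t n))).trans (hHC n)⟩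
  exact ⟨g, IsPFamily.of_perturb hpf hF.1, hF, hred.reduces hF.1 r⟩

/-- Composition with a quadratic polynomial doubles the degree. -/
theorem natDegree_comp_quadratic_ne_one (p : Polynomial K) {e : K} (he : e ≠ 0) :
    p.comp (Polynomial.X + Polynomial.C e * Polynomial.X ^ 2) ≠ Polynomial.X := by
  intro h
  have h₁ := congrArg Polynomial.natDegree h
  rw [Polynomial.natDegree_comp, Polynomial.natDegree_X, add_comm,
    Polynomial.natDegree_add_eq_left_of_natDegree_lt, Polynomial.natDegree_C_mul_X_pow 2 e he]
    at h₁
  · omega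
  · rw [Polynomial.natDegree_C_mul_X_pow 2 e he, Polynomial.natDegree_X]
    norm_num

/-- Every polynomial in VNP has a perturbation in VNP, obtained by replacing each variable `x`
by `x + ε x²`, that does not project to a variable. -/
theorem exists_perturb_not_isProjection_X {f : MvPolynomial ℕ K} {m : ℕ}
    (hf : IsHamiltonSum f m) : ∃ g, IsHamiltonSum (perturb f g) (m + 4 * (m * m)) ∧
      ¬ IsProjection (X 0) (perturb f g) := by
  classical
  obtain ⟨M, hM, rfl⟩ := hf
  -- Only the weights that are variables are perturbed; constants must stay as they are.
  let s : Fin m → Fin m → MvPolynomial ℕ K := fun i j => if ∃ k, M i j = X k then M i j else 0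
  have hs : ∀ i j, IsSimple (s i j) := fun i j => by
    simp only [s]
    split_ifs
    exacts [hM i j, isSimple_zero]
  let F : MvPolynomial ℕ (Polynomial K) := hamiltonSum fun i j =>
    map Polynomial.C (M i j) +
      C Polynomial.X * map Polynomial.C (s i j) * map Polynomial.C (s i j)
  obtain ⟨g, hg⟩ : ∃ g, toRat F = perturb (hamiltonSum M) g := by
    refine exists_perturb_eq ?_
    rw [map_hamiltonSum]
    congr 1
    funext i j
    have : (Polynomial.constantCoeff.comp Polynomial.C : K →+* K) = RingHom.id K := by
      ext
      simp
    simp [MvPolynomial.map_map, this, MvPolynomial.map_id]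
  have hF : perturb (hamiltonSum M) g = hamiltonSum fun i j =>
      lift (M i j) + C RatFunc.X * lift (s i j) * lift (s i j) := by
    rw [← hg, map_hamiltonSum]
    congr 1
    funext i j
    simp only [map_add, map_mul, toRat_map_C, map_C, RatFunc.algebraMap_X]
  refine ⟨g, ?_, ?_⟩
  · rw [hF]
    have := isHamiltonSum_add_mul (fun i j => lift (M i j)) (fun _ _ => C RatFunc.X)
      (fun i j => lift (s i j)) (fun i j => lift (s i j)) (fun _ _ => 0) (fun _ _ => 0)
      (fun _ _ => 0) (fun i j => (hM i j).map _) (fun _ _ => isSimple_C _)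
      (fun i j => (hs i j).map _) (fun i j => (hs i j).map _) (fun _ _ => isSimple_zero)
      (fun _ _ => isSimple_zero) (fun _ _ => isSimple_zero)
    simpa using this
  · rw [isProjection_iff, hF]
    rintro ⟨α, hα, h⟩
    set Q : Polynomial (RatFunc K) :=
      Polynomial.X + Polynomial.C RatFunc.X * Polynomial.X ^ 2 with hQ
    set ρ : MvPolynomial ℕ (RatFunc K) →ₐ[RatFunc K] Polynomial (RatFunc K) :=
      (aeval fun _ => Polynomial.X).comp (aeval α) with hρ
    -- After identifying all variables, each weight is a polynomial in `Q`: a variable sent to `X`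
    -- gives `Q`, everything else is constant. Hence the whole sum is a polynomial in `Q`.
    have hN : ∀ i j, ∃ N : Polynomial (RatFunc K),
        ρ (lift (M i j) + C RatFunc.X * lift (s i j) * lift (s i j)) = N.comp Q := by
      intro i j
      by_cases hX : ∃ k, M i j = X k
      · have hsX : s i j = M i j := if_pos hX
        obtain ⟨k, hk⟩ := hX
        rw [hsX, hk]
        have hρk : ρ (lift (X k)) = aeval (fun _ => Polynomial.X) (α k) := by
          simp [hρ, lift]
        have hρC : ρ (C RatFunc.X) = Polynomial.C RatFunc.X := by
          simp [Polynomial.algebraMap_eq]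
        rw [map_add, map_mul, map_mul, hρk, hρC]
        rcases IsSimple.aeval_eq_X_or_C (hα k) (fun _ => Polynomial.X) fun _ => Or.inl rfl
          with h | ⟨c, h⟩
        · refine ⟨Polynomial.X, ?_⟩
          rw [h, Polynomial.X_comp, hQ]
          ring
        · refine ⟨Polynomial.C (c + RatFunc.X * c * c), ?_⟩
          rw [h, Polynomial.C_comp]
          simp
      · have hs0 : s i j = 0 := if_neg hX
        obtain ⟨c, hc⟩ := (hM i j).resolve_left hX
        refine ⟨Polynomial.C (algebraMap K (RatFunc K) c), ?_⟩
        rw [hs0, hc, Polynomial.C_comp]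
        simp [hρ, lift, Polynomial.algebraMap_eq]
    choose N hN using hN
    have h₁ := congrArg (aeval fun _ : ℕ => (Polynomial.X : Polynomial (RatFunc K))) h
    rw [aeval_X, ← AlgHom.comp_apply] at h₁
    refine natDegree_comp_quadratic_ne_one (hamiltonSum N) (RatFunc.X_ne_zero (K := K)) ?_
    refine Eq.trans ?_ h₁.symm
    have h₂ := map_hamiltonSum ρ fun i j =>
      lift (M i j) + C RatFunc.X * lift (s i j) * lift (s i j)
    have h₃ := map_hamiltonSum (Polynomial.compRingHom Q) N
    refine h₃.trans (Eq.trans ?_ h₂.symm)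
    congr 1
    funext i j
    exact (hN i j).symm

theorem isDenseIn_diff_VNPC (K : Type u) [Field K] : IsDenseIn (Diff VNP (VNPC .p)) VNP K := by
  refine ⟨fun f hf => hf.1, fun f hf => ⟨hf.1, ?_⟩⟩
  have hpf := hf.1
  obtain ⟨t, ht, h⟩ := mem_VNP_iff.1 hf
  choose g hg hX using fun n => exists_perturb_not_isProjection_X (h n)
  have hF : (fun n => perturb (f n) (g n)) ∈ VNP (RatFunc K) :=
    mem_VNP_iff.2 ⟨_, ht.add ((PolyBounded.const 4).mul (ht.mul ht)), hg⟩
  refine ⟨g, IsPFamily.of_perturb hpf hF.1, hF, fun hc => ?_⟩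
  obtain ⟨-, t', -, ht'⟩ := hc
  -- The Hamiltonian cycle polynomial on one vertex is the variable `X 0`.
  refine hX (t' 1) ?_
  have h₁ := ht' 1
  rwa [HC_eq, hamiltonSum_unique (α := Fin 1)] at h₁

end Density

end AlgComplexity

theorem theorem1 (K : Type u) [Field K] :
    (∀ r : AlgComplexity.ReductionKind,
      AlgComplexity.IsDenseIn (AlgComplexity.VNPC r) AlgComplexity.VNP K ∧
      AlgComplexity.IsDenseIn (AlgComplexity.Complete AlgComplexity.VF r) AlgComplexity.VF K ∧
      AlgComplexity.IsDenseIn (AlgComplexity.Complete AlgComplexity.VBP r) AlgComplexity.VBP K ∧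
      AlgComplexity.IsDenseIn (AlgComplexity.Complete AlgComplexity.VP r) AlgComplexity.VP K) ∧
    AlgComplexity.IsDenseIn
      (AlgComplexity.Diff AlgComplexity.VNP (AlgComplexity.VNPC .p)) AlgComplexity.VNP K ∧
    AlgComplexity.IsDenseIn
      (AlgComplexity.Diff AlgComplexity.VF (AlgComplexity.Complete AlgComplexity.VF .p))
      AlgComplexity.VF K ∧
    AlgComplexity.IsDenseIn
      (AlgComplexity.Diff AlgComplexity.VBP (AlgComplexity.Complete AlgComplexity.VBP .p))
      AlgComplexity.VBP K ∧
    AlgComplexity.IsDenseIn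
      (AlgComplexity.Diff AlgComplexity.VP (AlgComplexity.Complete AlgComplexity.VP .p))
      AlgComplexity.VP K := by
  open AlgComplexity in
  exact ⟨fun r => ⟨isDenseIn_VNP K r, isDenseIn_VF K r, isDenseIn_VBP K r, isDenseIn_VP K r⟩,
    isDenseIn_diff_VNPC K, isDenseIn_diff_complete isMeasure_formulaLE,
    VBP_eq ▸ isDenseIn_diff_complete (isMeasure_compLE True),
    VP_eq ▸ isDenseIn_diff_complete (isMeasure_compLE False)⟩
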